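/- Let $\mathbb L^4$ be $\mathbb R^4$ with $\langle x,y\rangle=-x_0y_0+x_1y_1+x_2y_2+x_3y_3$, also extended complex-bilinearly to $\mathbb C^4$, and let $\mathcal C=\{x:\langle x,x\rangle=0,\ x_0>0\}$ be the future light cone. Let $M\subset\mathbb C$ be open, connected and simply connected. For a smooth $f:M\to\mathbb L^4$ write $f_w=\tfrac12(f_u-if_v)$ and $f_{\overline w}=\tfrac12(f_u+if_v)$, where $w=u+iv$. Call $f$ a conformal immersion if it is a smooth immersion with $\langle f_w,f_w\rangle=0$ and $\langle f_w,\overline{f_w}\rangle>0$ on $M$. It is totally umbilical if the component $[f_{ww}]^\perp$ of $f_{ww}$ orthogonal to $f_w$ and $\overline{f_w}$ vanishes on $M$. Its mean curvature vector is $H(f)=f_{w\overline w}/\langle f_w,\overline{f_w}\rangle$. Where $f_{1,w}-if_{2,w}\neq0$, put $$a(f)=\frac{f_{0,w}+f_{3,w}}{f_{1,w}-if_{2,w}},\qquad b(f)=\frac{f_{0,w}-f_{3,w}}{f_{1,w}-if_{2,w}},\qquad \mu(f)=\frac{f_{1,w}-if_{2,w}}{2}.$$ Let $F:M\to\mathbb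 L^4$ be a totally umbilical conformal immersion with $F_{1,w}-iF_{2,w}\ne0$ everywhere on $M$, such that $a(F)$ and $b(F)$ are non-constant anti-holomorphic functions on $M$. Then: 1. There is a conformal immersion $f:M\to\mathbb L^4$ with values in the light cone such that $a(f)=a(F)$, $b(f)=b(F)$ and $\mu(f)=\mu(F)$ on $M$. It can be taken with values in the future light cone $\mathcal C$ unless $H(F)$ is timelike and past directed at every point of $M$; in that case it can be taken with values in the past light cone $-\mathcal C$. 2. There is a vector $v$ with $\langle v,v\rangle=1$ or $\langle v,v\rangle=-1$ such that $F(M)\subset F(w_0)+v^\perp$ for every $w_0\in M$. Moreover, whenever $w_0\in M$ and $v\in\mathbb L^4$ are such that $F(M)\subset F(w_0)+v^\perp$: (2.1) if $\langle v,v\rangle=-1$, then for some $r>0$ an affine isometry of $\mathbb L^4$ maps $F(M)$ onto a relatively open subset of the round sphere $\{x_0=0,\ x_1^2+x_2^2+x_3^2=r^2\}$ of $\mathbb R^3=\{x_0=0\}$; (2.2) if $\langle v,v\rangle=1$, then for some $r>0$ an affine isometry of $\mathbb L^4$ maps $F(M)$ onto a relatively open subset of the hyperbolic surface $\{x_3=0,\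 -x_0^2+x_1^2+x_2^2=-r^2,\ x_0>0\}$ of $\mathbb R^3_1=\{x_3=0\}$. -/

import Mathlib

open scoped ContDiff

noncomputable section

/-- The underlying vector space of Minkowski space, coordinates `x 0, x 1, x 2, x 3`. -/
abbrev L4 : Type := Fin 4 → ℝ

/-- The Lorentz product `-x₀y₀ + x₁y₁ + x₂y₂ + x₃y₃`. -/
def lor (x y : L4) : ℝ := -(x 0 * y 0) + x 1 * y 1 + x 2 * y 2 + x 3 * y 3

/-- The complex bilinear extension of the Lorentz product to `ℂ⁴`. -/
def lorC (x y : Fin 4 → ℂ) : ℂ := -(x 0 * y 0) + x 1 * y 1 + x 2 * y 2 + x 3 * y 3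

/-- Componentwise complex conjugation on `ℂ⁴`. -/
def conjVec (z : Fin 4 → ℂ) : Fin 4 → ℂ := fun j => (starRingEnd ℂ) (z j)

/-- `∂g/∂w = (∂g/∂u - i ∂g/∂v) / 2` for `w = u + i v`. -/
def dw (g : ℂ → ℂ) (w : ℂ) : ℂ :=
  (fderiv ℝ g w 1 - Complex.I * fderiv ℝ g w Complex.I) / 2

/-- `∂g/∂w̄ = (∂g/∂u + i ∂g/∂v) / 2` for `w = u + i v`. -/
def dwbar (g : ℂ → ℂ) (w : ℂ) : ℂ :=
  (fderiv ℝ g w 1 + Complex.I * fderiv ℝ g w Complex.I) / 2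

/-- The vector `f_w ∈ ℂ⁴`. -/
def fw (f : ℂ → L4) (w : ℂ) : Fin 4 → ℂ := fun j => dw (fun z => (f z j : ℂ)) w

/-- The vector `f_{ww} ∈ ℂ⁴`. -/
def fww (f : ℂ → L4) (w : ℂ) : Fin 4 → ℂ := fun j => dw (fun z => fw f z j) w

/-- The vector `f_{w w̄} ∈ ℂ⁴`. -/
def fwwbar (f : ℂ → L4) (w : ℂ) : Fin 4 → ℂ := fun j => dwbar (fun z => fw f z j) w

/-- `f` is a smooth conformal spacelike immersion of the open set `M` into Minkowski space. -/
structure IsConformalImmersion (f : ℂ → L4) (M : Set ℂ) : Prop where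
  smooth : ContDiffOn ℝ ∞ f M
  immersion : ∀ w ∈ M, Function.Injective (fderiv ℝ f w)
  isotropic : ∀ w ∈ M, lorC (fw f w) (fw f w) = 0
  spacelike : ∀ w ∈ M, ∃ r : ℝ, 0 < r ∧
    lorC (fw f w) (conjVec (fw f w)) = ((r ^ 2 / 2 : ℝ) : ℂ)

/-- The function `f_{1,w} - i f_{2,w}`, the denominator in `a(f)` and `b(f)`. -/
def den (f : ℂ → L4) (w : ℂ) : ℂ := fw f w 1 - Complex.I * fw f w 2

/-- `a(f)`. -/
def aMap (f : ℂ → L4) (w : ℂ) : ℂ := (fw f w 0 + fw f w 3) / den f w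

/-- `b(f)`. -/
def bMap (f : ℂ → L4) (w : ℂ) : ℂ := (fw f w 0 - fw f w 3) / den f w

/-- `μ(f)`. -/
def muMap (f : ℂ → L4) (w : ℂ) : ℂ := den f w / 2

/-- The component of `z ∈ ℂ⁴` orthogonal to the complexified tangent plane of a conformal
immersion `f` at `w`. That plane is spanned by the isotropic vectors `f_w` and `conj f_w`. -/
def normalPart (f : ℂ → L4) (w : ℂ) (z : Fin 4 → ℂ) : Fin 4 → ℂ :=
  z - (lorC z (conjVec (fw f w)) / lorC (fw f w) (conjVec (fw f w))) • fw f w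
    - (lorC z (fw f w) / lorC (fw f w) (conjVec (fw f w))) • conjVec (fw f w)

/-- A conformal immersion is totally umbilical if the normal part of `f_{ww}` vanishes. -/
def IsTotallyUmbilical (f : ℂ → L4) (M : Set ℂ) : Prop :=
  ∀ w ∈ M, normalPart f w (fww f w) = 0

/-- `a` is anti-holomorphic on `M`: its conjugate is holomorphic. -/
def IsAntiHolomorphicOn (a : ℂ → ℂ) (M : Set ℂ) : Prop :=
  DifferentiableOn ℂ (fun w => (starRingEnd ℂ) (a w)) M

/-- `a` is constant on `M`. -/
def IsConstantOn (a : ℂ → ℂ) (M : Set ℂ) : Prop := ∃ c : ℂ, ∀ w ∈ M, a w = c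

/-- The mean curvature vector `H(f) = (2 / g₁₁) f_{w w̄}` with `g₁₁ = 2 ⟨f_w, conj f_w⟩`. For a
smooth `f` the vector `f_{w w̄}` is real, so the real parts are all of it. -/
def meanCurvature (f : ℂ → L4) (w : ℂ) : L4 := fun j =>
  2 / (2 * (lorC (fw f w) (conjVec (fw f w))).re) * (fwwbar f w j).re

/-- Past directed timelike vectors. -/
def IsPastTimelike (x : L4) : Prop := lor x x < 0 ∧ x 0 < 0

/-- The future directed light cone. -/
def futureCone : Set L4 := {x | lor x x = 0 ∧ 0 < x 0}

/-- The past directed light cone. -/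
def pastCone : Set L4 := {x | lor x x = 0 ∧ x 0 < 0}

/-- The affine hyperplane `p + v^⊥`. -/
def affHyperplane (p v : L4) : Set L4 := {x | lor (x - p) v = 0}

/-- `f` and `F` have the same `a`, `b` and `μ` on `M`. -/
def SameData (f F : ℂ → L4) (M : Set ℂ) : Prop :=
  ∀ w ∈ M, aMap f w = aMap F w ∧ bMap f w = bMap F w ∧ muMap f w = muMap F w

/-- Two subsets are congruent if an affine isometry of Minkowski space maps one onto the other. -/
def LorentzCongruent (S S' : Set L4) : Prop :=
  ∃ T : L4 ≃ᵃ[ℝ] L4,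
    (∀ x y : L4, lor (T x - T y) (T x - T y) = lor (x - y) (x - y)) ∧ T '' S = S'

/-- The round sphere of radius `r` in the Euclidean space `ℝ³ = {x₀ = 0}`. -/
def roundSphere (r : ℝ) : Set L4 := {x | x 0 = 0 ∧ lor x x = r ^ 2}

/-- The hyperbolic surface of radius `r` (one sheet of the hyperboloid `⟨x, x⟩ = -r²`) in the
Lorentzian space `ℝ³₁ = {x₃ = 0}`. -/
def hyperbolicSurface (r : ℝ) : Set L4 := {x | x 3 = 0 ∧ lor x x = -r ^ 2 ∧ 0 < x 0}

/-- `S` is congruent to a relatively open piece of `Q`. -/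
def CongruentToOpenPiece (S Q : Set L4) : Prop :=
  ∃ U : Set L4, IsOpen U ∧ LorentzCongruent S (U ∩ Q)

end

/-!
Write `ρ = ⟨F_w, conj F_w⟩` and let `H` be the mean curvature vector. Umbilicity says
`F_ww = κ F_w`; comparing `(F_ww)_w̄` with `(ρ H)_w` shows that `H_w` is tangent, and since `H` is
normal, `H_w = -⟨H, H⟩ F_w`. Hence three quantities are constant: `s = ⟨H, H⟩`, the normal vector
`v = i ρ⁻¹ F_w × conj F_w × H` with `⟨v, v⟩ = -s`, and, if `s ≠ 0`, the center `p = F + s⁻¹ H`.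

If `s = 0`, then `H` itself is constant. Either it vanishes, and `a` and `b` are constant, or it is
a null vector orthogonal to `F_w`, a condition on the isotropic direction `F_w` that forces `a` or
`b` to take a fixed value at each point; being anti-holomorphic, one of them is then constant.

So `s ≠ 0`. The translate `F - p + s⁻¹ v = s⁻¹ (v - H)` is null and has product `-1` with both `v`
and `H`, one of which is timelike and decides which half of the light cone contains it. Moreover
`F - p` lies in `v^⊥` and in the quadric `⟨x, x⟩ = s⁻¹`; its image is open there because the
projection to a tangent plane is a local diffeomorphism both on the surface and on the quadric.
-/

/-! ### The Lorentz product -/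

lemma lor_comm (x y : L4) : lor x y = lor y x := by
  simp only [lor]; ring

lemma lor_add_left (x y z : L4) : lor (x + y) z = lor x z + lor y z := by
  simp only [lor, Pi.add_apply]; ring

lemma lor_smul_left (c : ℝ) (x y : L4) : lor (c • x) y = c * lor x y := by
  simp only [lor, Pi.smul_apply, smul_eq_mul]; ring

lemma lor_add_right (x y z : L4) : lor x (y + z) = lor x y + lor x z := by
  simp only [lor, Pi.add_apply]; ring

lemma lor_smul_right (c : ℝ) (x y : L4) : lor x (c • y) = c * lor x y := by
  simp only [lor, Pi.smul_apply, smul_eq_mul]; ring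

/-- The Lorentz product as a bilinear form. -/
noncomputable def lorForm : L4 →ₗ[ℝ] L4 →ₗ[ℝ] ℝ :=
  LinearMap.mk₂ ℝ lor lor_add_left lor_smul_left lor_add_right lor_smul_right

lemma isSymm_lorForm : lorForm.IsSymm := ⟨fun x y => lor_comm x y⟩

lemma lor_sub_left (x y z : L4) : lor (x - y) z = lor x z - lor y z :=
  LinearMap.map_sub₂ lorForm x y z

lemma lor_sub_right (x y z : L4) : lor x (y - z) = lor x y - lor x z :=
  map_sub (lorForm x) y z

lemma lor_neg_left (x y : L4) : lor (-x) y = -lor x y :=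
  LinearMap.map_neg₂ lorForm x y

lemma lor_neg_right (x y : L4) : lor x (-y) = -lor x y :=
  map_neg (lorForm x) y

lemma lor_neg_neg (x y : L4) : lor (-x) (-y) = lor x y := by
  rw [lor_neg_left, lor_neg_right, neg_neg]

lemma continuous_lor_left (y : L4) : Continuous fun x => lor x y := by
  unfold lor; fun_prop

lemma time_ne_zero_of_lor_self_neg {x : L4} (hx : lor x x < 0) : x 0 ≠ 0 := by
  intro h
  simp only [lor, h] at hx
  nlinarith [sq_nonneg (x 1), sq_nonneg (x 2), sq_nonneg (x 3)]

lemma space_sq_le_of_lor_self_nonpos {x : L4} (hx : lor x x ≤ 0) :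
    x 1 ^ 2 + x 2 ^ 2 + x 3 ^ 2 ≤ x 0 ^ 2 := by
  simp only [lor] at hx
  linarith

lemma lor_nonneg_of_opposite_time {x y : L4} (hx : lor x x ≤ 0) (hy : lor y y ≤ 0)
    (hx0 : x 0 ≤ 0) (hy0 : 0 ≤ y 0) : 0 ≤ lor x y := by
  have cauchy_schwarz : (x 1 * y 1 + x 2 * y 2 + x 3 * y 3) ^ 2 ≤
      (x 1 ^ 2 + x 2 ^ 2 + x 3 ^ 2) * (y 1 ^ 2 + y 2 ^ 2 + y 3 ^ 2) := by
    simpa [Fin.sum_univ_three] using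
      Finset.sum_mul_sq_le_sq_mul_sq Finset.univ (fun i : Fin 3 => x i.succ) (fun i => y i.succ)
  have time_dominates : (x 1 * y 1 + x 2 * y 2 + x 3 * y 3) ^ 2 ≤ (x 0 * y 0) ^ 2 := by
    rw [mul_pow]
    exact cauchy_schwarz.trans (mul_le_mul (space_sq_le_of_lor_self_nonpos hx)
      (space_sq_le_of_lor_self_nonpos hy) (by positivity) (sq_nonneg _))
  have habs := (abs_le.1 (sq_le_sq.1 time_dominates)).1
  rw [abs_of_nonpos (mul_nonpos_of_nonpos_of_nonneg hx0 hy0)] at habs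
  simp only [lor]
  linarith

lemma mem_futureCone_of_lor_neg {x y : L4} (hx : lor x x = 0) (hy : lor y y ≤ 0)
    (hy0 : 0 < y 0) (hxy : lor x y < 0) : x ∈ futureCone :=
  ⟨hx, not_le.1 fun hx0 => hxy.not_ge (lor_nonneg_of_opposite_time hx.le hy hx0 hy0.le)⟩

lemma mem_pastCone_of_lor_neg {x y : L4} (hx : lor x x = 0) (hy : lor y y ≤ 0)
    (hy0 : y 0 < 0) (hxy : lor x y < 0) : x ∈ pastCone := by
  have h : -x ∈ futureCone := mem_futureCone_of_lor_neg (y := -y) (by rwa [lor_neg_neg])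
    (by rwa [lor_neg_neg]) (neg_pos.2 hy0) (by rwa [lor_neg_neg])
  exact ⟨hx, neg_pos.1 h.2⟩

/-! ### The complex bilinear Lorentz product -/

lemma lorC_comm (x y : Fin 4 → ℂ) : lorC x y = lorC y x := by
  simp only [lorC]; ring

lemma lorC_sub_left (x y z : Fin 4 → ℂ) : lorC (x - y) z = lorC x z - lorC y z := by
  simp only [lorC, Pi.sub_apply]; ring

lemma lorC_smul_left (c : ℂ) (x y : Fin 4 → ℂ) : lorC (c • x) y = c * lorC x y := by
  simp only [lorC, Pi.smul_apply, smul_eq_mul]; ring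

lemma lorC_smul_right (c : ℂ) (x y : Fin 4 → ℂ) : lorC x (c • y) = c * lorC x y := by
  simp only [lorC, Pi.smul_apply, smul_eq_mul]; ring

lemma lorC_zero_left (x : Fin 4 → ℂ) : lorC 0 x = 0 := by simp [lorC]

lemma lorC_zero_right (x : Fin 4 → ℂ) : lorC x 0 = 0 := by simp [lorC]

lemma conjVec_conjVec (x : Fin 4 → ℂ) : conjVec (conjVec x) = x := by
  funext j; simp [conjVec]

lemma conjVec_smul (c : ℂ) (x : Fin 4 → ℂ) :
    conjVec (c • x) = (starRingEnd ℂ) c • conjVec x := by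
  funext j; simp [conjVec]

lemma lorC_conjVec_conjVec (x y : Fin 4 → ℂ) :
    lorC (conjVec x) (conjVec y) = (starRingEnd ℂ) (lorC x y) := by
  simp [lorC, conjVec]

/-- The inclusion of `ℝ⁴` into its complexification `ℂ⁴`. -/
def toC (x : L4) : Fin 4 → ℂ := fun j => (x j : ℂ)

lemma toC_injective : Function.Injective toC := fun _ _ h =>
  funext fun j => Complex.ofReal_injective (congrFun h j)

lemma toC_zero : toC 0 = 0 := funext fun _ => Complex.ofReal_zero

lemma toC_add (x y : L4) : toC (x + y) = toC x + toC y := by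
  funext j; simp [toC]

lemma toC_sub (x y : L4) : toC (x - y) = toC x - toC y := by
  funext j; simp [toC]

lemma toC_smul (c : ℝ) (x : L4) : toC (c • x) = (c : ℂ) • toC x := by
  funext j; simp [toC]

lemma conjVec_toC (x : L4) : conjVec (toC x) = toC x := by
  funext j; simp [conjVec, toC]

lemma exists_toC_eq {z : Fin 4 → ℂ} (hz : conjVec z = z) : ∃ x : L4, toC x = z :=
  ⟨fun j => (z j).re, funext fun j => Complex.conj_eq_iff_re.1 (congrFun hz j)⟩

lemma lorC_toC_toC (x y : L4) : lorC (toC x) (toC y) = (lor x y : ℂ) := by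
  simp [lorC, lor, toC]

lemma lorC_toC_conjVec (x : L4) (y : Fin 4 → ℂ) :
    lorC (toC x) (conjVec y) = (starRingEnd ℂ) (lorC (toC x) y) := by
  rw [← lorC_conjVec_conjVec, conjVec_toC]

lemma lorC_toC_conjVec_eq_zero_iff {x : L4} {y : Fin 4 → ℂ} :
    lorC (toC x) (conjVec y) = 0 ↔ lorC (toC x) y = 0 := by
  rw [lorC_toC_conjVec, map_eq_zero]

lemma lorC_eq_dotProduct (x y : Fin 4 → ℂ) :
    lorC x y = x ⬝ᵥ (Matrix.diagonal ![-1, 1, 1, 1]).mulVec y := by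
  simp [lorC, dotProduct, Fin.sum_univ_four, Matrix.mulVec_diagonal]

lemma eq_zero_of_det_gram_ne_zero {b : Fin 4 → Fin 4 → ℂ} {d : Fin 4 → ℂ}
    (hb : (Matrix.of fun i j => lorC (b i) (b j)).det ≠ 0) (hd : ∀ i, lorC (b i) d = 0) :
    d = 0 := by
  let B : Matrix (Fin 4) (Fin 4) ℂ := Matrix.of b
  let η : Matrix (Fin 4) (Fin 4) ℂ := Matrix.diagonal ![-1, 1, 1, 1]
  have hgram : Matrix.of (fun i j => lorC (b i) (b j)) = B * (η * B.transpose) := by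
    ext i j
    rw [Matrix.of_apply, lorC_eq_dotProduct]
    simp [Matrix.mul_apply, dotProduct, Matrix.mulVec, B, η]
  have hB : (B * η).det ≠ 0 := by
    rw [hgram, ← Matrix.mul_assoc, Matrix.det_mul] at hb
    exact left_ne_zero_of_mul hb
  refine Matrix.eq_zero_of_mulVec_eq_zero hB (funext fun i => ?_)
  rw [← Matrix.mulVec_mulVec]
  exact (lorC_eq_dotProduct (b i) d).symm.trans (hd i)

lemma eq_zero_of_orthogonal_hyperbolic_pair {x y u v d : Fin 4 → ℂ}
    (hxx : lorC x x = 0) (hyy : lorC y y = 0) (hxy : lorC x y ≠ 0)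
    (hxu : lorC x u = 0) (hyu : lorC y u = 0) (hxv : lorC x v = 0) (hyv : lorC y v = 0)
    (huv : lorC u v = 0) (huu : lorC u u ≠ 0) (hvv : lorC v v ≠ 0)
    (hxd : lorC x d = 0) (hyd : lorC y d = 0) (hud : lorC u d = 0) (hvd : lorC v d = 0) :
    d = 0 := by
  refine eq_zero_of_det_gram_ne_zero (b := ![x, y, u, v]) ?_ (by simp [Fin.forall_fin_succ, *])
  have hgram : Matrix.of (fun i j => lorC (![x, y, u, v] i) (![x, y, u, v] j)) =
      !![0, lorC x y, 0, 0; lorC x y, 0, 0, 0; 0, 0, lorC u u, 0; 0, 0, 0, lorC v v] := by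
    ext i j
    fin_cases i <;> fin_cases j <;>
      simp [lorC_comm y x, lorC_comm u x, lorC_comm u y, lorC_comm v x, lorC_comm v y,
        lorC_comm v u, *]
  have hdet : (Matrix.of fun i j => lorC (![x, y, u, v] i) (![x, y, u, v] j)).det =
      -(lorC x y ^ 2 * lorC u u * lorC v v) := by
    rw [hgram]
    simp [Matrix.det_succ_row_zero, Fin.sum_univ_succ, Fin.succAbove]
    ring
  rw [hdet]
  exact neg_ne_zero.2 (mul_ne_zero (mul_ne_zero (pow_ne_zero 2 hxy) huu) hvv)

/-- The `3 × 3` minor on the columns `i, j, k` of the matrix with rows `x, y, z`. -/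
def minor3 (x y z : Fin 4 → ℂ) (i j k : Fin 4) : ℂ :=
  x i * (y j * z k - y k * z j) - x j * (y i * z k - y k * z i) + x k * (y i * z j - y j * z i)

/-- The triple cross product of `ℂ⁴`, characterized by `⟨x × y × z, u⟩ = det (u, x, y, z)`. -/
def crossC (x y z : Fin 4 → ℂ) : Fin 4 → ℂ :=
  ![-minor3 x y z 1 2 3, -minor3 x y z 0 2 3, minor3 x y z 0 1 3, -minor3 x y z 0 1 2]

lemma lorC_crossC_left (x y z : Fin 4 → ℂ) : lorC (crossC x y z) x = 0 := by
  simp only [lorC, crossC, minor3, Matrix.cons_val]; ring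

lemma lorC_crossC_self (x y z : Fin 4 → ℂ) : lorC (crossC x y z) (crossC x y z) =
    -(lorC x x * (lorC y y * lorC z z - lorC y z ^ 2)
      - lorC x y * (lorC x y * lorC z z - lorC y z * lorC x z)
      + lorC x z * (lorC x y * lorC y z - lorC y y * lorC x z)) := by
  simp only [lorC, crossC, minor3, Matrix.cons_val]; ring

lemma crossC_swap (x y z : Fin 4 → ℂ) : crossC y x z = -crossC x y z := by
  funext j; fin_cases j <;> simp [crossC, minor3] <;> ring

lemma crossC_smul_left (c : ℂ) (x y z : Fin 4 → ℂ) : crossC (c • x) y z = c • crossC x y z := by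
  funext j; fin_cases j <;> simp [crossC, minor3] <;> ring

lemma crossC_smul_mid (c : ℂ) (x y z : Fin 4 → ℂ) : crossC x (c • y) z = c • crossC x y z := by
  funext j; fin_cases j <;> simp [crossC, minor3] <;> ring

lemma crossC_smul_right (c : ℂ) (x y z : Fin 4 → ℂ) : crossC x y (c • z) = c • crossC x y z := by
  funext j; fin_cases j <;> simp [crossC, minor3] <;> ring

lemma crossC_self_left (x y : Fin 4 → ℂ) : crossC x y x = 0 := by
  funext j; fin_cases j <;> simp [crossC, minor3] <;> ring

lemma crossC_self_right (x y : Fin 4 → ℂ) : crossC x y y = 0 := by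
  funext j; fin_cases j <;> simp [crossC, minor3] <;> ring

lemma conjVec_crossC (x y z : Fin 4 → ℂ) :
    conjVec (crossC x y z) = crossC (conjVec x) (conjVec y) (conjVec z) := by
  funext j; fin_cases j <;> simp [crossC, minor3, conjVec]

/-! ### Wirtinger calculus -/

section Wirtinger

variable {E : Type*} [NormedAddCommGroup E] [NormedSpace ℝ E] [NormedSpace ℂ E]
  [IsScalarTower ℝ ℂ E]

/-- `g` is real differentiable at `w` with `∂g/∂w = p` and `∂g/∂w̄ = q`, that is, its differential
is `p dw + q dw̄`. -/
def HasWirtingerAt (g : ℂ → E) (p q : E) (w : ℂ) : Prop :=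
  HasFDerivAt g ((ContinuousLinearMap.id ℝ ℂ).smulRight p +
    (Complex.conjCLE : ℂ →L[ℝ] ℂ).smulRight q) w

namespace HasWirtingerAt

variable {g h : ℂ → E} {p q p' q' : E} {w : ℂ}

lemma unique (hg : HasWirtingerAt g p q w) (hg' : HasWirtingerAt g p' q' w) :
    p = p' ∧ q = q' := by
  have hfderiv := HasFDerivAt.unique hg hg'
  have hsum : p + q = p' + q' := by simpa using DFunLike.congr_fun hfderiv 1
  have hdiff : p - q = p' - q' := by
    have hI := DFunLike.congr_fun hfderiv Complex.I
    simp only [add_apply, ContinuousLinearMap.smulRight_apply, ContinuousLinearMap.id_apply,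
      ContinuousLinearEquiv.coe_coe, Complex.conjCLE_apply, Complex.conj_I, neg_smul,
      ← sub_eq_add_neg, ← smul_sub] at hI
    exact smul_right_injective E Complex.I_ne_zero hI
  have hp : (2 : ℂ) • p = (2 : ℂ) • p' := by
    rw [two_smul, two_smul, ← add_add_sub_cancel p p q, hsum, hdiff, add_add_sub_cancel]
  obtain rfl := smul_right_injective E two_ne_zero hp
  exact ⟨rfl, add_left_cancel hsum⟩

lemma congr_deriv (hg : HasWirtingerAt g p q w) (hp : p = p') (hq : q = q') :
    HasWirtingerAt g p' q' w := hp ▸ hq ▸ hg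

lemma congr_on {M : Set ℂ} (hg : HasWirtingerAt g p q w) (hMo : IsOpen M) (hw : w ∈ M)
    (hgh : ∀ z ∈ M, h z = g z) : HasWirtingerAt h p q w :=
  HasFDerivAt.congr_of_eventuallyEq hg (Filter.eventuallyEq_of_mem (hMo.mem_nhds hw) hgh)

lemma const (c : E) : HasWirtingerAt (fun _ => c) 0 0 w :=
  HasFDerivAt.congr_fderiv (hasFDerivAt_const c w) (by ext z; simp)

lemma add (hg : HasWirtingerAt g p q w) (hh : HasWirtingerAt h p' q' w) :
    HasWirtingerAt (fun z => g z + h z) (p + p') (q + q') w :=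
  (HasFDerivAt.add hg hh).congr_fderiv (by ext z; simp; abel)

lemma sub (hg : HasWirtingerAt g p q w) (hh : HasWirtingerAt h p' q' w) :
    HasWirtingerAt (fun z => g z - h z) (p - p') (q - q') w :=
  (HasFDerivAt.sub hg hh).congr_fderiv (by ext z; simp [smul_sub]; abel)

lemma smul {c : ℂ → ℂ} {r s : ℂ} (hc : HasWirtingerAt c r s w) (hg : HasWirtingerAt g p q w) :
    HasWirtingerAt (fun z => c z • g z) (r • g w + c w • p) (s • g w + c w • q) w :=
  (HasFDerivAt.smul hc hg).congr_fderiv (by ext z; simp; module)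

lemma eq_of_isPreconnected {M : Set ℂ} (hMo : IsOpen M) (hMc : IsPreconnected M)
    (hg : ∀ z ∈ M, HasWirtingerAt g 0 0 z) {z₁ z₂ : ℂ} (h₁ : z₁ ∈ M) (h₂ : z₂ ∈ M) :
    g z₁ = g z₂ := by
  have hg' : ∀ z ∈ M, HasFDerivAt g (0 : ℂ →L[ℝ] E) z := fun z hz =>
    HasFDerivAt.congr_fderiv (hg z hz) (by ext z; simp)
  exact hMo.is_const_of_fderiv_eq_zero hMc
    (fun z hz => (hg' z hz).differentiableAt.differentiableWithinAt)
    (fun z hz => (hg' z hz).fderiv) h₁ h₂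

end HasWirtingerAt

end Wirtinger

lemma hasWirtingerAt_pi {ι : Type*} [Fintype ι] {x : ℂ → ι → ℂ} {p q : ι → ℂ} {w : ℂ} :
    HasWirtingerAt x p q w ↔ ∀ j, HasWirtingerAt (fun z => x z j) (p j) (q j) w :=
  hasFDerivAt_pi'

lemma hasWirtingerAt_dw_dwbar {g : ℂ → ℂ} {w : ℂ} (hg : DifferentiableAt ℝ g w) :
    HasWirtingerAt g (dw g w) (dwbar g w) w := by
  refine hg.hasFDerivAt.congr_fderiv (ContinuousLinearMap.coe_injective
    (Complex.basisOneI.ext fun i => ?_))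
  fin_cases i
  · simp [dw, dwbar]; ring
  · simp [dw, dwbar]; linear_combination fderiv ℝ g w Complex.I * Complex.I_sq

namespace HasWirtingerAt

variable {g h : ℂ → ℂ} {p q p' q' w : ℂ}

lemma dw_eq (hg : HasWirtingerAt g p q w) : dw g w = p :=
  ((hasWirtingerAt_dw_dwbar (HasFDerivAt.differentiableAt hg)).unique hg).1

lemma dwbar_eq (hg : HasWirtingerAt g p q w) : dwbar g w = q :=
  ((hasWirtingerAt_dw_dwbar (HasFDerivAt.differentiableAt hg)).unique hg).2

lemma mul (hg : HasWirtingerAt g p q w) (hh : HasWirtingerAt h p' q' w) :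
    HasWirtingerAt (fun z => g z * h z) (p * h w + g w * p') (q * h w + g w * q') w :=
  hg.smul hh

lemma inv (hg : HasWirtingerAt g p q w) (hgw : g w ≠ 0) :
    HasWirtingerAt (fun z => (g z)⁻¹) (-p / g w ^ 2) (-q / g w ^ 2) w :=
  (((hasDerivAt_inv hgw).hasFDerivAt.restrictScalars ℝ).comp w hg).congr_fderiv
    (by ext z; simp; ring)

lemma conj (hg : HasWirtingerAt g p q w) : HasWirtingerAt (fun z => (starRingEnd ℂ) (g z))
    ((starRingEnd ℂ) q) ((starRingEnd ℂ) p) w :=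
  ((Complex.conjCLE : ℂ →L[ℝ] ℂ).hasFDerivAt.comp w hg).congr_fderiv (by ext z; simp; ring)

lemma differentiableAt_conj (hg : HasWirtingerAt g 0 q w) :
    DifferentiableAt ℂ (fun z => (starRingEnd ℂ) (g z)) w := by
  have hconj : HasFDerivAt (fun z => (starRingEnd ℂ) (g z))
      (((ContinuousLinearMap.id ℂ ℂ).smulRight ((starRingEnd ℂ) q)).restrictScalars ℝ) w :=
    HasFDerivAt.congr_fderiv hg.conj (by ext z; simp)
  exact (hasFDerivAt_of_restrictScalars ℝ hconj rfl).differentiableAt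

end HasWirtingerAt

section ContDiff

variable {g : ℂ → ℂ} {M : Set ℂ} {w : ℂ}

lemma contDiffOn_fderiv_apply (hg : ContDiffOn ℝ ∞ g M) (hMo : IsOpen M) (e : ℂ) :
    ContDiffOn ℝ ∞ (fun z => fderiv ℝ g z e) M :=
  (hg.fderiv_of_isOpen hMo (by simp)).clm_apply contDiffOn_const

lemma contDiffOn_dw (hg : ContDiffOn ℝ ∞ g M) (hMo : IsOpen M) : ContDiffOn ℝ ∞ (dw g) M :=
  ((contDiffOn_fderiv_apply hg hMo 1).sub
    (contDiffOn_const.mul (contDiffOn_fderiv_apply hg hMo Complex.I))).div_const 2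

lemma contDiffOn_dwbar (hg : ContDiffOn ℝ ∞ g M) (hMo : IsOpen M) : ContDiffOn ℝ ∞ (dwbar g) M :=
  ((contDiffOn_fderiv_apply hg hMo 1).add
    (contDiffOn_const.mul (contDiffOn_fderiv_apply hg hMo Complex.I))).div_const 2

lemma hasWirtingerAt_of_contDiffOn (hg : ContDiffOn ℝ ∞ g M) (hMo : IsOpen M) (hw : w ∈ M) :
    HasWirtingerAt g (dw g w) (dwbar g w) w :=
  hasWirtingerAt_dw_dwbar ((hg.contDiffAt (hMo.mem_nhds hw)).differentiableAt (by simp))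

lemma dwbar_dw_comm (hg : ContDiffOn ℝ ∞ g M) (hMo : IsOpen M) (hw : w ∈ M) :
    dwbar (dw g) w = dw (dwbar g) w := by
  have hsymm : IsSymmSndFDerivAt ℝ g w := (hg.contDiffAt (hMo.mem_nhds hw)).isSymmSndFDerivAt
    (by simpa using WithTop.coe_le_coe.2 (le_top (a := (2 : ℕ∞))))
  have hd : DifferentiableAt ℝ (fderiv ℝ g) w :=
    ((hg.fderiv_of_isOpen hMo (m := ∞) (by simp)).contDiffAt (hMo.mem_nhds hw)).differentiableAt
      (by simp)
  set D := fderiv ℝ (fderiv ℝ g) w with hD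
  have hpartial (e : ℂ) : HasFDerivAt (fun z => fderiv ℝ g z e) (D.flip e) w := by
    simpa using hd.hasFDerivAt.clm_apply (hasFDerivAt_const e w)
  have hdw : HasFDerivAt (dw g) ((2⁻¹ : ℂ) • (D.flip 1 - Complex.I • D.flip Complex.I)) w :=
    (((hpartial 1).sub ((hpartial Complex.I).const_mul Complex.I)).const_mul
      (2⁻¹ : ℂ)).congr_of_eventuallyEq
      (.of_forall fun z => (div_eq_inv_mul _ _ : dw g z = _))
  have hdwbar : HasFDerivAt (dwbar g) ((2⁻¹ : ℂ) • (D.flip 1 + Complex.I • D.flip Complex.I)) w :=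
    (((hpartial 1).add ((hpartial Complex.I).const_mul Complex.I)).const_mul
      (2⁻¹ : ℂ)).congr_of_eventuallyEq
      (.of_forall fun z => (div_eq_inv_mul _ _ : dwbar g z = _))
  rw [dw, dwbar, hdw.fderiv, hdwbar.fderiv]
  simp only [smul_apply, sub_apply, add_apply, ContinuousLinearMap.flip_apply, smul_eq_mul, hD]
  rw [hsymm.eq 1 Complex.I]
  ring

end ContDiff

namespace HasWirtingerAt

variable {x y z : ℂ → Fin 4 → ℂ} {p q p' q' p'' q'' : Fin 4 → ℂ} {w : ℂ}

lemma fun_conjVec (hx : HasWirtingerAt x p q w) :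
    HasWirtingerAt (fun u => conjVec (x u)) (conjVec q) (conjVec p) w :=
  hasWirtingerAt_pi.2 fun j => (hasWirtingerAt_pi.1 hx j).conj

lemma fun_lorC (hx : HasWirtingerAt x p q w) (hy : HasWirtingerAt y p' q' w) :
    HasWirtingerAt (fun u => lorC (x u) (y u)) (lorC p (y w) + lorC (x w) p')
      (lorC q (y w) + lorC (x w) q') w := by
  rw [hasWirtingerAt_pi] at hx hy
  have h := (((((const 0).sub ((hx 0).mul (hy 0)))).add ((hx 1).mul (hy 1))).add
    ((hx 2).mul (hy 2))).add ((hx 3).mul (hy 3))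
  simp only [zero_sub] at h
  exact h.congr_deriv (by simp only [lorC]; ring) (by simp only [lorC]; ring)

lemma fun_minor3 (hx : HasWirtingerAt x p q w) (hy : HasWirtingerAt y p' q' w)
    (hz : HasWirtingerAt z p'' q'' w) (i j k : Fin 4) :
    HasWirtingerAt (fun u => minor3 (x u) (y u) (z u) i j k)
      (minor3 p (y w) (z w) i j k + minor3 (x w) p' (z w) i j k + minor3 (x w) (y w) p'' i j k)
      (minor3 q (y w) (z w) i j k + minor3 (x w) q' (z w) i j k + minor3 (x w) (y w) q'' i j k)
      w := by
  rw [hasWirtingerAt_pi] at hx hy hz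
  have h := (((hx i).mul (((hy j).mul (hz k)).sub ((hy k).mul (hz j)))).sub
    ((hx j).mul (((hy i).mul (hz k)).sub ((hy k).mul (hz i))))).add
    ((hx k).mul (((hy i).mul (hz j)).sub ((hy j).mul (hz i))))
  exact h.congr_deriv (by simp only [minor3]; ring) (by simp only [minor3]; ring)

lemma fun_crossC (hx : HasWirtingerAt x p q w) (hy : HasWirtingerAt y p' q' w)
    (hz : HasWirtingerAt z p'' q'' w) :
    HasWirtingerAt (fun u => crossC (x u) (y u) (z u))
      (crossC p (y w) (z w) + crossC (x w) p' (z w) + crossC (x w) (y w) p'')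
      (crossC q (y w) (z w) + crossC (x w) q' (z w) + crossC (x w) (y w) q'') w := by
  have hminor := fun_minor3 hx hy hz
  have hneg (i j k) := (const 0).sub (hminor i j k)
  simp only [zero_sub] at hneg
  rw [hasWirtingerAt_pi]
  intro j
  fin_cases j
  · exact (hneg 1 2 3).congr_deriv (by simp [crossC]; ring) (by simp [crossC]; ring)
  · exact (hneg 0 2 3).congr_deriv (by simp [crossC]; ring) (by simp [crossC]; ring)
  · exact (hminor 0 1 3).congr_deriv (by simp [crossC]) (by simp [crossC])
  · exact (hneg 0 1 2).congr_deriv (by simp [crossC]; ring) (by simp [crossC]; ring)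

end HasWirtingerAt

lemma HasWirtingerAt.eq_conjVec_of_toC {x : ℂ → L4} {p q : Fin 4 → ℂ} {w : ℂ}
    (hx : HasWirtingerAt (fun z => toC (x z)) p q w) : q = conjVec p := by
  have hconj := hx.fun_conjVec
  simp only [conjVec_toC] at hconj
  exact (hx.unique hconj).2

lemma HasWirtingerAt.orthogonal_of_isotropic {x : ℂ → Fin 4 → ℂ} {p q : Fin 4 → ℂ} {M : Set ℂ}
    {w : ℂ} (hx : HasWirtingerAt x p q w) (hMo : IsOpen M) (hw : w ∈ M)
    (hxx : ∀ z ∈ M, lorC (x z) (x z) = 0) : lorC p (x w) = 0 ∧ lorC q (x w) = 0 := by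
  have hconst : HasWirtingerAt (fun z => lorC (x z) (x z)) 0 0 w :=
    (HasWirtingerAt.const 0).congr_on hMo hw hxx
  obtain ⟨hp, hq⟩ := (hx.fun_lorC hx).unique hconst
  rw [lorC_comm (x w)] at hp hq
  exact ⟨self_eq_neg.1 (eq_neg_of_add_eq_zero_left hp),
    self_eq_neg.1 (eq_neg_of_add_eq_zero_left hq)⟩

/-! ### Structure equations of a totally umbilical surface -/

section Smooth

variable {F : ℂ → L4} {M : Set ℂ} {w : ℂ}

lemma contDiffOn_toC_comp (hF : ContDiffOn ℝ ∞ F M) (j : Fin 4) :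
    ContDiffOn ℝ ∞ (fun z => (F z j : ℂ)) M :=
  Complex.ofRealCLM.contDiff.comp_contDiffOn (contDiffOn_pi.1 hF j)

lemma contDiffOn_fw (hF : ContDiffOn ℝ ∞ F M) (hMo : IsOpen M) : ContDiffOn ℝ ∞ (fw F) M :=
  contDiffOn_pi.2 fun j => contDiffOn_dw (contDiffOn_toC_comp hF j) hMo

lemma contDiffOn_fww (hF : ContDiffOn ℝ ∞ F M) (hMo : IsOpen M) : ContDiffOn ℝ ∞ (fww F) M :=
  contDiffOn_pi.2 fun j => contDiffOn_dw (contDiffOn_pi.1 (contDiffOn_fw hF hMo) j) hMo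

lemma contDiffOn_fwwbar (hF : ContDiffOn ℝ ∞ F M) (hMo : IsOpen M) :
    ContDiffOn ℝ ∞ (fwwbar F) M :=
  contDiffOn_pi.2 fun j => contDiffOn_dwbar (contDiffOn_pi.1 (contDiffOn_fw hF hMo) j) hMo

lemma hasWirtingerAt_toC_comp (hF : ContDiffOn ℝ ∞ F M) (hMo : IsOpen M) (hw : w ∈ M) :
    HasWirtingerAt (fun z => toC (F z)) (fw F w) (conjVec (fw F w)) w := by
  have hF' : HasWirtingerAt (fun z => toC (F z)) (fw F w) _ w := hasWirtingerAt_pi.2 fun j =>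
    hasWirtingerAt_of_contDiffOn (contDiffOn_toC_comp hF j) hMo hw
  exact hF'.congr_deriv rfl hF'.eq_conjVec_of_toC

lemma hasWirtingerAt_fw (hF : ContDiffOn ℝ ∞ F M) (hMo : IsOpen M) (hw : w ∈ M) :
    HasWirtingerAt (fw F) (fww F w) (fwwbar F w) w := hasWirtingerAt_pi.2 fun j =>
  hasWirtingerAt_of_contDiffOn (contDiffOn_pi.1 (contDiffOn_fw hF hMo) j) hMo hw

lemma conjVec_fwwbar (hF : ContDiffOn ℝ ∞ F M) (hMo : IsOpen M) (hw : w ∈ M) :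
    conjVec (fwwbar F w) = fwwbar F w := by
  funext j
  have hdwbar : HasWirtingerAt (dwbar fun z => (F z j : ℂ)) _ _ w :=
    (hasWirtingerAt_pi.1 (hasWirtingerAt_fw hF hMo hw).fun_conjVec j).congr_on hMo hw
      fun z hz => (hasWirtingerAt_pi.1 (hasWirtingerAt_toC_comp hF hMo hz) j).dwbar_eq
  exact hdwbar.dw_eq.symm.trans (dwbar_dw_comm (contDiffOn_toC_comp hF j) hMo hw).symm

lemma dwbar_fww_eq_dw_fwwbar (hF : ContDiffOn ℝ ∞ F M) (hMo : IsOpen M) (hw : w ∈ M)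
    {p q p' q' : Fin 4 → ℂ} (hfww : HasWirtingerAt (fww F) p q w)
    (hfwwbar : HasWirtingerAt (fwwbar F) p' q' w) : q = p' := by
  funext j
  rw [← (hasWirtingerAt_pi.1 hfww j).dwbar_eq, ← (hasWirtingerAt_pi.1 hfwwbar j).dw_eq]
  exact dwbar_dw_comm (contDiffOn_pi.1 (contDiffOn_fw hF hMo) j) hMo hw

lemma orthogonal_fw_of_lor_eq_const (hF : ContDiffOn ℝ ∞ F M) (hMo : IsOpen M) {v : L4} {c : ℝ}
    (hv : ∀ z ∈ M, lor v (F z) = c) (hw : w ∈ M) : lorC (toC v) (fw F w) = 0 := by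
  have hderiv := (HasWirtingerAt.const (toC v)).fun_lorC (hasWirtingerAt_toC_comp hF hMo hw)
  have hconst : HasWirtingerAt (fun z => lorC (toC v) (toC (F z))) 0 0 w :=
    (HasWirtingerAt.const (c : ℂ)).congr_on hMo hw fun z hz => by rw [lorC_toC_toC, hv z hz]
  simpa only [lorC_zero_left, zero_add] using (hderiv.unique hconst).1

lemma lor_eq_lor_of_orthogonal_fw (hF : ContDiffOn ℝ ∞ F M) (hMo : IsOpen M)
    (hMc : IsPreconnected M) {v : L4} (hv : ∀ z ∈ M, lorC (toC v) (fw F z) = 0)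
    {z₁ z₂ : ℂ} (h₁ : z₁ ∈ M) (h₂ : z₂ ∈ M) : lor v (F z₁) = lor v (F z₂) := by
  have hderiv : ∀ z ∈ M, HasWirtingerAt (fun u => lorC (toC v) (toC (F u))) 0 0 z := fun z hz =>
    ((HasWirtingerAt.const (toC v)).fun_lorC (hasWirtingerAt_toC_comp hF hMo hz)).congr_deriv
      (by rw [hv z hz, lorC_zero_left, zero_add])
      (by rw [lorC_zero_left, zero_add, lorC_toC_conjVec_eq_zero_iff, hv z hz])
  have hconst := HasWirtingerAt.eq_of_isPreconnected hMo hMc hderiv h₁ h₂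
  simp only [lorC_toC_toC] at hconst
  exact_mod_cast hconst

end Smooth

/-- The conformal factor `⟨f_w, conj f_w⟩`; the induced metric is twice this multiple of
`|dw|²`. -/
noncomputable def conformalFactor (f : ℂ → L4) (w : ℂ) : ℂ := lorC (fw f w) (conjVec (fw f w))

/-- The factor `κ` for which `f_ww = κ f_w` on a totally umbilical surface. -/
noncomputable def umbilicFactor (f : ℂ → L4) (w : ℂ) : ℂ :=
  lorC (fww f w) (conjVec (fw f w)) / conformalFactor f w

lemma contDiffOn_lorC {x y : ℂ → Fin 4 → ℂ} {M : Set ℂ} (hx : ContDiffOn ℝ ∞ x M)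
    (hy : ContDiffOn ℝ ∞ y M) : ContDiffOn ℝ ∞ (fun z => lorC (x z) (y z)) M := by
  unfold lorC
  fun_prop

lemma contDiffOn_conjVec {x : ℂ → Fin 4 → ℂ} {M : Set ℂ} (hx : ContDiffOn ℝ ∞ x M) :
    ContDiffOn ℝ ∞ (fun z => conjVec (x z)) M :=
  contDiffOn_pi.2 fun j =>
    (Complex.conjCLE : ℂ →L[ℝ] ℂ).contDiff.comp_contDiffOn (contDiffOn_pi.1 hx j)

namespace IsConformalImmersion

variable {F : ℂ → L4} {M : Set ℂ} {w : ℂ}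

lemma exists_conformalFactor_eq_ofReal (hF : IsConformalImmersion F M) (hw : w ∈ M) :
    ∃ ρ : ℝ, 0 < ρ ∧ conformalFactor F w = ρ := by
  obtain ⟨r, hr, h⟩ := hF.spacelike w hw
  exact ⟨r ^ 2 / 2, by positivity, h⟩

lemma conformalFactor_ne_zero (hF : IsConformalImmersion F M) (hw : w ∈ M) :
    conformalFactor F w ≠ 0 := by
  obtain ⟨ρ, hρ, h⟩ := hF.exists_conformalFactor_eq_ofReal hw
  exact h ▸ Complex.ofReal_ne_zero.2 hρ.ne'

lemma contDiffOn_conformalFactor (hF : IsConformalImmersion F M) (hMo : IsOpen M) :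
    ContDiffOn ℝ ∞ (conformalFactor F) M :=
  contDiffOn_lorC (contDiffOn_fw hF.smooth hMo) (contDiffOn_conjVec (contDiffOn_fw hF.smooth hMo))

lemma contDiffOn_umbilicFactor (hF : IsConformalImmersion F M) (hMo : IsOpen M) :
    ContDiffOn ℝ ∞ (umbilicFactor F) M :=
  (contDiffOn_lorC (contDiffOn_fww hF.smooth hMo)
    (contDiffOn_conjVec (contDiffOn_fw hF.smooth hMo))).mul
    ((hF.contDiffOn_conformalFactor hMo).inv fun _ hz => hF.conformalFactor_ne_zero hz)

lemma lorC_fww_fw (hF : IsConformalImmersion F M) (hMo : IsOpen M) (hw : w ∈ M) :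
    lorC (fww F w) (fw F w) = 0 :=
  ((hasWirtingerAt_fw hF.smooth hMo hw).orthogonal_of_isotropic hMo hw hF.isotropic).1

lemma lorC_fwwbar_fw (hF : IsConformalImmersion F M) (hMo : IsOpen M) (hw : w ∈ M) :
    lorC (fwwbar F w) (fw F w) = 0 :=
  ((hasWirtingerAt_fw hF.smooth hMo hw).orthogonal_of_isotropic hMo hw hF.isotropic).2

lemma fww_eq_umbilicFactor_smul (hF : IsConformalImmersion F M) (hMo : IsOpen M)
    (humb : IsTotallyUmbilical F M) (hw : w ∈ M) : fww F w = umbilicFactor F w • fw F w := by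
  have hnormal := humb w hw
  rwa [normalPart, hF.lorC_fww_fw hMo hw, zero_div, zero_smul, sub_zero,
    sub_eq_zero] at hnormal

lemma conformalFactor_smul_meanCurvature (hF : IsConformalImmersion F M) (hMo : IsOpen M)
    (hw : w ∈ M) : conformalFactor F w • toC (meanCurvature F w) = fwwbar F w := by
  obtain ⟨ρ, hρ, hF'⟩ := hF.exists_conformalFactor_eq_ofReal hw
  obtain ⟨h, hh⟩ := exists_toC_eq (conjVec_fwwbar hF.smooth hMo hw)
  have hH : meanCurvature F w = ρ⁻¹ • h := by
    funext j
    rw [conformalFactor] at hF'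
    simp only [meanCurvature, hF', ← hh, toC, Complex.ofReal_re, Pi.smul_apply, smul_eq_mul]
    field_simp
  rw [hF', ← toC_smul, hH, smul_inv_smul₀ hρ.ne', hh]

lemma lorC_meanCurvature_fw (hF : IsConformalImmersion F M) (hMo : IsOpen M) (hw : w ∈ M) :
    lorC (toC (meanCurvature F w)) (fw F w) = 0 := by
  have h := hF.lorC_fwwbar_fw hMo hw
  rw [← hF.conformalFactor_smul_meanCurvature hMo hw, lorC_smul_left] at h
  exact (mul_eq_zero.1 h).resolve_left (hF.conformalFactor_ne_zero hw)

lemma lorC_meanCurvature_conjVec_fw (hF : IsConformalImmersion F M) (hMo : IsOpen M)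
    (hw : w ∈ M) : lorC (toC (meanCurvature F w)) (conjVec (fw F w)) = 0 :=
  lorC_toC_conjVec_eq_zero_iff.2 (hF.lorC_meanCurvature_fw hMo hw)

lemma contDiffOn_meanCurvature (hF : IsConformalImmersion F M) (hMo : IsOpen M) :
    ContDiffOn ℝ ∞ (fun z => toC (meanCurvature F z)) M :=
  (((hF.contDiffOn_conformalFactor hMo).inv fun _ hz => hF.conformalFactor_ne_zero hz).smul
    (contDiffOn_fwwbar hF.smooth hMo)).congr fun z hz => by
      rw [Pi.smul_apply', Pi.inv_apply, ← hF.conformalFactor_smul_meanCurvature hMo hz,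
        inv_smul_smul₀ (hF.conformalFactor_ne_zero hz)]

lemma hasWirtingerAt_conformalFactor (hF : IsConformalImmersion F M) (hMo : IsOpen M)
    (humb : IsTotallyUmbilical F M) (hw : w ∈ M) :
    HasWirtingerAt (conformalFactor F) (umbilicFactor F w * conformalFactor F w)
      ((starRingEnd ℂ) (umbilicFactor F w) * conformalFactor F w) w := by
  have hfw := hasWirtingerAt_fw hF.smooth hMo hw
  rw [hF.fww_eq_umbilicFactor_smul hMo humb hw, ← hF.conformalFactor_smul_meanCurvature hMo hw]
    at hfw
  refine (hfw.fun_lorC hfw.fun_conjVec).congr_deriv ?_ ?_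
  · rw [hF.conformalFactor_smul_meanCurvature hMo hw, conjVec_fwwbar hF.smooth hMo hw,
      lorC_comm (fw F w), hF.lorC_fwwbar_fw hMo hw, lorC_smul_left, add_zero,
      conformalFactor]
  · rw [lorC_smul_left, hF.lorC_meanCurvature_conjVec_fw hMo hw, conjVec_smul, lorC_smul_right,
      mul_zero, zero_add, conformalFactor]

/-- The Codazzi equation: comparing `(f_ww)_w̄` with `(f_ww̄)_w` for `f_ww = κ f_w` and
`f_ww̄ = ρ H` gives `ρ H_w = κ_w̄ f_w`. -/
lemma exists_hasWirtingerAt_meanCurvature (hF : IsConformalImmersion F M) (hMo : IsOpen M)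
    (humb : IsTotallyUmbilical F M) (hw : w ∈ M) :
    ∃ l : ℂ, HasWirtingerAt (fun z => toC (meanCurvature F z)) (l • fw F w)
      ((starRingEnd ℂ) l • conjVec (fw F w)) w := by
  have hρ := hF.conformalFactor_ne_zero hw
  obtain ⟨p, hH⟩ : ∃ p, HasWirtingerAt (fun z => toC (meanCurvature F z)) p (conjVec p) w := by
    have hH := hasWirtingerAt_pi.2 fun j => hasWirtingerAt_of_contDiffOn
      (contDiffOn_pi.1 (hF.contDiffOn_meanCurvature hMo) j) hMo hw
    exact ⟨_, hH.congr_deriv rfl hH.eq_conjVec_of_toC⟩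
  have hfwwbar : HasWirtingerAt (fwwbar F) _ _ w :=
    ((hF.hasWirtingerAt_conformalFactor hMo humb hw).smul hH).congr_on hMo hw
      fun z hz => (hF.conformalFactor_smul_meanCurvature hMo hz).symm
  have hfww : HasWirtingerAt (fww F) _ _ w :=
    ((hasWirtingerAt_of_contDiffOn (hF.contDiffOn_umbilicFactor hMo) hMo hw).smul
      (hasWirtingerAt_fw hF.smooth hMo hw)).congr_on hMo hw
      fun z hz => hF.fww_eq_umbilicFactor_smul hMo humb hz
  have hcodazzi := dwbar_fww_eq_dw_fwwbar hF.smooth hMo hw hfww hfwwbar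
  rw [← hF.conformalFactor_smul_meanCurvature hMo hw, add_comm, smul_smul,
    add_left_cancel_iff] at hcodazzi
  have hp : p = (dwbar (umbilicFactor F) w / conformalFactor F w) • fw F w := by
    rw [div_eq_inv_mul, mul_smul, hcodazzi, inv_smul_smul₀ hρ]
  exact ⟨_, hH.congr_deriv hp (by rw [hp, conjVec_smul])⟩

/-- Since `H` is normal, differentiating `⟨H, f_w⟩ = 0` determines the factor in the Codazzi
equation. -/
lemma hasWirtingerAt_meanCurvature (hF : IsConformalImmersion F M) (hMo : IsOpen M)
    (humb : IsTotallyUmbilical F M) (hw : w ∈ M) :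
    HasWirtingerAt (fun z => toC (meanCurvature F z))
      (-(lor (meanCurvature F w) (meanCurvature F w) : ℂ) • fw F w)
      (-(lor (meanCurvature F w) (meanCurvature F w) : ℂ) • conjVec (fw F w)) w := by
  obtain ⟨l, hH⟩ := hF.exists_hasWirtingerAt_meanCurvature hMo humb hw
  have hconst : HasWirtingerAt (fun z => lorC (toC (meanCurvature F z)) (fw F z)) 0 0 w :=
    (HasWirtingerAt.const 0).congr_on hMo hw fun z hz => hF.lorC_meanCurvature_fw hMo hz
  have hdwbar := ((hH.fun_lorC (hasWirtingerAt_fw hF.smooth hMo hw)).unique hconst).2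
  rw [← hF.conformalFactor_smul_meanCurvature hMo hw, lorC_smul_left, lorC_smul_right,
    lorC_toC_toC, lorC_comm (conjVec _), ← conformalFactor, mul_comm, ← mul_add] at hdwbar
  have hl : (starRingEnd ℂ) l = -(lor (meanCurvature F w) (meanCurvature F w) : ℂ) :=
    eq_neg_of_add_eq_zero_left
      ((mul_eq_zero.1 hdwbar).resolve_left (hF.conformalFactor_ne_zero hw))
  have hl' : l = -(lor (meanCurvature F w) (meanCurvature F w) : ℂ) := by
    rw [← Complex.conj_conj l, hl, map_neg, Complex.conj_ofReal]
  rwa [hl, hl'] at hH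

lemma lor_meanCurvature_self_eq (hF : IsConformalImmersion F M) (hMo : IsOpen M)
    (hMc : IsPreconnected M) (humb : IsTotallyUmbilical F M) {z₁ z₂ : ℂ} (h₁ : z₁ ∈ M)
    (h₂ : z₂ ∈ M) : lor (meanCurvature F z₁) (meanCurvature F z₁) =
      lor (meanCurvature F z₂) (meanCurvature F z₂) := by
  have hderiv : ∀ z ∈ M, HasWirtingerAt
      (fun u => lorC (toC (meanCurvature F u)) (toC (meanCurvature F u))) 0 0 z := fun z hz => by
    have hH := hF.hasWirtingerAt_meanCurvature hMo humb hz
    refine (hH.fun_lorC hH).congr_deriv ?_ ?_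
    · rw [lorC_comm, lorC_smul_right, hF.lorC_meanCurvature_fw hMo hz, mul_zero, add_zero]
    · rw [lorC_comm, lorC_smul_right, hF.lorC_meanCurvature_conjVec_fw hMo hz, mul_zero, add_zero]
  have hconst := HasWirtingerAt.eq_of_isPreconnected hMo hMc hderiv h₁ h₂
  simp only [lorC_toC_toC] at hconst
  exact_mod_cast hconst

end IsConformalImmersion

/-! ### The constant normal and the center -/

/-- The vector `i ρ⁻¹ f_w × conj f_w × H`, normal to the surface and to its mean curvature vector;
on a conformal immersion it is real. -/
noncomputable def crossNormal (f : ℂ → L4) (w : ℂ) : Fin 4 → ℂ :=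
  (Complex.I * (conformalFactor f w)⁻¹) •
    crossC (fw f w) (conjVec (fw f w)) (toC (meanCurvature f w))

namespace IsConformalImmersion

variable {F : ℂ → L4} {M : Set ℂ} {w : ℂ}

lemma hasWirtingerAt_crossNormal (hF : IsConformalImmersion F M) (hMo : IsOpen M)
    (humb : IsTotallyUmbilical F M) (hw : w ∈ M) : HasWirtingerAt (crossNormal F) 0 0 w := by
  have hρ := hF.conformalFactor_ne_zero hw
  have hfw := hasWirtingerAt_fw hF.smooth hMo hw
  have hcross := hfw.fun_crossC hfw.fun_conjVec (hF.hasWirtingerAt_meanCurvature hMo humb hw)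
  rw [conjVec_fwwbar hF.smooth hMo hw, ← hF.conformalFactor_smul_meanCurvature hMo hw,
    hF.fww_eq_umbilicFactor_smul hMo humb hw, conjVec_smul] at hcross
  simp only [crossC_smul_left, crossC_smul_mid, crossC_smul_right, crossC_self_left,
    crossC_self_right, smul_zero, add_zero, zero_add] at hcross
  refine (((HasWirtingerAt.const Complex.I).mul
    ((hF.hasWirtingerAt_conformalFactor hMo humb hw).inv hρ)).smul hcross).congr_deriv ?_ ?_
  all_goals
    rw [smul_smul, ← add_smul]
    refine smul_eq_zero_of_left ?_ _
    field_simp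
    ring

lemma conjVec_crossNormal (hF : IsConformalImmersion F M) (hw : w ∈ M) :
    conjVec (crossNormal F w) = crossNormal F w := by
  obtain ⟨ρ, -, hρ⟩ := hF.exists_conformalFactor_eq_ofReal hw
  rw [crossNormal, conjVec_smul, conjVec_crossC, conjVec_conjVec, conjVec_toC, crossC_swap, hρ]
  simp

lemma lorC_crossNormal_self (hF : IsConformalImmersion F M) (hMo : IsOpen M) (hw : w ∈ M) :
    lorC (crossNormal F w) (crossNormal F w) =
      -(lor (meanCurvature F w) (meanCurvature F w) : ℂ) := by
  have hρ := hF.conformalFactor_ne_zero hw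
  rw [crossNormal, lorC_smul_left, lorC_smul_right, lorC_crossC_self, hF.isotropic w hw,
    lorC_comm (fw F w) (toC _), hF.lorC_meanCurvature_fw hMo hw,
    lorC_comm (conjVec _) (toC _), hF.lorC_meanCurvature_conjVec_fw hMo hw, lorC_toC_toC,
    ← conformalFactor]
  field_simp
  rw [Complex.I_sq]
  ring

lemma exists_normal (hF : IsConformalImmersion F M) (hMo : IsOpen M) (hMc : IsPreconnected M)
    (humb : IsTotallyUmbilical F M) (hw : w ∈ M) :
    ∃ v : L4, lor v v = -lor (meanCurvature F w) (meanCurvature F w) ∧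
      ∀ z ∈ M, lorC (toC v) (fw F z) = 0 := by
  obtain ⟨v, hv⟩ := exists_toC_eq (hF.conjVec_crossNormal hw)
  have hvF : ∀ z ∈ M, toC v = crossNormal F z := fun z hz =>
    hv.trans (HasWirtingerAt.eq_of_isPreconnected hMo hMc
      (fun u hu => hF.hasWirtingerAt_crossNormal hMo humb hu) hw hz)
  refine ⟨v, ?_, fun z hz => ?_⟩
  · have hnorm := hF.lorC_crossNormal_self hMo hw
    rw [← hv, lorC_toC_toC] at hnorm
    exact_mod_cast hnorm
  · rw [hvF z hz, crossNormal, lorC_smul_left, lorC_crossC_left, mul_zero]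

lemma lor_meanCurvature_eq_zero_of_orthogonal (hF : IsConformalImmersion F M) (hMo : IsOpen M)
    {v : L4} (hv : ∀ z ∈ M, lorC (toC v) (fw F z) = 0) (hw : w ∈ M) :
    lor v (meanCurvature F w) = 0 := by
  have hconst : HasWirtingerAt (fun z => lorC (toC v) (fw F z)) 0 0 w :=
    (HasWirtingerAt.const 0).congr_on hMo hw hv
  have hdwbar := (((HasWirtingerAt.const (toC v)).fun_lorC
    (hasWirtingerAt_fw hF.smooth hMo hw)).unique hconst).2
  rw [lorC_zero_left, zero_add, ← hF.conformalFactor_smul_meanCurvature hMo hw,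
    lorC_smul_right, lorC_toC_toC] at hdwbar
  exact_mod_cast (mul_eq_zero.1 hdwbar).resolve_left (hF.conformalFactor_ne_zero hw)

lemma exists_center (hF : IsConformalImmersion F M) (hMo : IsOpen M) (hMc : IsPreconnected M)
    {s : ℝ} (hs : ∀ z ∈ M, lor (meanCurvature F z) (meanCurvature F z) = s) (hs0 : s ≠ 0)
    (humb : IsTotallyUmbilical F M) : ∃ p : L4, ∀ z ∈ M, F z - p = -s⁻¹ • meanCurvature F z := by
  obtain rfl | ⟨w, hw⟩ := M.eq_empty_or_nonempty
  · exact ⟨0, by simp⟩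
  refine ⟨F w + s⁻¹ • meanCurvature F w, fun z hz => ?_⟩
  have hderiv : ∀ u ∈ M, HasWirtingerAt
      (fun u => toC (F u) + ((s⁻¹ : ℝ) : ℂ) • toC (meanCurvature F u)) 0 0 u := fun u hu => by
    have hs' : (s : ℂ) ≠ 0 := Complex.ofReal_ne_zero.2 hs0
    have hH := hF.hasWirtingerAt_meanCurvature hMo humb hu
    rw [hs u hu] at hH
    refine ((hasWirtingerAt_toC_comp hF.smooth hMo hu).add
      ((HasWirtingerAt.const _).smul hH)).congr_deriv ?_ ?_ <;>
    rw [zero_smul, zero_add, smul_smul, Complex.ofReal_inv, mul_neg, inv_mul_cancel₀ hs',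
      neg_one_smul, add_neg_cancel]
  have hconst := HasWirtingerAt.eq_of_isPreconnected hMo hMc hderiv hz hw
  simp only [← toC_smul, ← toC_add] at hconst
  rw [← toC_injective hconst]
  module

end IsConformalImmersion

/-! ### Non-constant data -/

/-- The isotropic vector with data `a`, `b` and `μ = 1`: every isotropic `z ∈ ℂ⁴` with
`z₁ - i z₂ ≠ 0` is a multiple of such a vector. -/
def isotropicVec (a b : ℂ) : Fin 4 → ℂ :=
  ![a + b, 1 + a * b, Complex.I * (1 - a * b), a - b]

lemma exists_eq_or_eq_of_orthogonal_null {n : L4} (hn : n ≠ 0) (hnull : lor n n = 0) :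
    ∃ c d : ℂ, ∀ a b : ℂ, lorC (toC n) (isotropicVec a b) = 0 → a = c ∨ b = d := by
  set ζ : ℂ := n 1 - Complex.I * n 2 with hζ
  have hexpand (a b : ℂ) : lorC (toC n) (isotropicVec a b) =
      (n 1 + Complex.I * n 2) + a * b * ζ - a * (n 0 - n 3) - b * (n 0 + n 3) := by
    simp only [lorC, toC, isotropicVec, Matrix.cons_val, hζ]
    ring
  have hnullC : (n 1 + Complex.I * n 2) * ζ = (n 0 + n 3) * (n 0 - n 3) := by
    have hnull' : (lor n n : ℂ) = 0 := by exact_mod_cast hnull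
    simp only [lor] at hnull'
    push_cast at hnull'
    linear_combination hnull' - (n 2 : ℂ) ^ 2 * Complex.I_sq
  by_cases hζ0 : ζ = 0
  · have hn1 : n 1 = 0 := by simpa [hζ] using congrArg Complex.re hζ0
    have hn2 : n 2 = 0 := by simpa [hζ] using congrArg Complex.im hζ0
    have hn03 : (n 0 : ℂ) + n 3 ≠ 0 ∨ (n 0 : ℂ) - n 3 ≠ 0 := by
      by_contra! h
      have h₁ : n 0 + n 3 = 0 := by exact_mod_cast h.1
      have h₂ : n 0 - n 3 = 0 := by exact_mod_cast h.2
      exact hn (funext (by simp [Fin.forall_fin_succ, hn1, hn2]; constructor <;> linarith))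
    refine ⟨0, 0, fun a b hab => ?_⟩
    simp only [hexpand, hζ0, hn1, hn2, Complex.ofReal_zero, mul_zero, add_zero, zero_sub] at hab
    rw [hζ0, mul_zero, eq_comm, mul_eq_zero] at hnullC
    grind
  · refine ⟨(n 0 + n 3) / ζ, (n 0 - n 3) / ζ, fun a b hab => ?_⟩
    rw [eq_div_iff hζ0, eq_div_iff hζ0, ← sub_eq_zero, ← sub_eq_zero (a := b * ζ), ← mul_eq_zero]
    rw [hexpand] at hab
    linear_combination ζ * hab - hnullC

lemma isConstantOn_or_isConstantOn_of_forall_eq_or_eq {a b : ℂ → ℂ} {M : Set ℂ} {c d : ℂ}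
    (hMo : IsOpen M) (hMc : IsPreconnected M) (ha : IsAntiHolomorphicOn a M)
    (hb : IsAntiHolomorphicOn b M) (hab : ∀ w ∈ M, a w = c ∨ b w = d) :
    IsConstantOn a M ∨ IsConstantOn b M := by
  have hanalytic {g : ℂ → ℂ} (e : ℂ) (hg : IsAntiHolomorphicOn g M) :
      AnalyticOnNhd ℂ (fun w => (starRingEnd ℂ) (g w) - (starRingEnd ℂ) e) M :=
    (hg.sub_const _).analyticOnNhd hMo
  have hconst {g : ℂ → ℂ} {e : ℂ}
      (hg : ∀ w ∈ M, (starRingEnd ℂ) (g w) - (starRingEnd ℂ) e = 0) : IsConstantOn g M :=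
    ⟨e, fun w hw => (starRingEnd ℂ).injective (sub_eq_zero.1 (hg w hw))⟩
  refine ((hanalytic c ha).eq_zero_or_eq_zero_of_mul_eq_zero (hanalytic d hb)
    (fun w hw => ?_) hMc).imp hconst hconst
  rcases hab w hw with h | h <;> simp [h]

lemma HasWirtingerAt.isConstantOn {g : ℂ → ℂ} {M : Set ℂ} (hMo : IsOpen M)
    (hMc : IsPreconnected M) (hg : ∀ z ∈ M, HasWirtingerAt g 0 0 z) : IsConstantOn g M := by
  obtain rfl | ⟨w, hw⟩ := M.eq_empty_or_nonempty
  · exact ⟨0, by simp⟩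
  · exact ⟨g w, fun z hz => HasWirtingerAt.eq_of_isPreconnected hMo hMc hg hz hw⟩

lemma HasWirtingerAt.div_of_proportional {g h : ℂ → ℂ} {κ q q' w : ℂ}
    (hg : HasWirtingerAt g (κ * g w) q w) (hh : HasWirtingerAt h (κ * h w) q' w)
    (hw : h w ≠ 0) :
    HasWirtingerAt (fun z => g z / h z) 0 ((q * h w - g w * q') / h w ^ 2) w := by
  simp only [div_eq_mul_inv (g _)]
  exact (hg.mul (hh.inv hw)).congr_deriv (by field_simp; ring) (by field_simp; ring)

namespace IsConformalImmersion

variable {F : ℂ → L4} {M : Set ℂ} {w : ℂ}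

lemma fw_eq_muMap_smul_isotropicVec (hF : IsConformalImmersion F M) (hw : w ∈ M)
    (hden : den F w ≠ 0) : fw F w = muMap F w • isotropicVec (aMap F w) (bMap F w) := by
  have ha : aMap F w * den F w = fw F w 0 + fw F w 3 := div_mul_cancel₀ _ hden
  have hb : bMap F w * den F w = fw F w 0 - fw F w 3 := div_mul_cancel₀ _ hden
  have hab : aMap F w * bMap F w * den F w = fw F w 1 + Complex.I * fw F w 2 := by
    apply mul_right_cancel₀ hden
    have hiso := hF.isotropic w hw
    calc aMap F w * bMap F w * den F w * den F w
        = (fw F w 0 + fw F w 3) * (fw F w 0 - fw F w 3) := by rw [← ha, ← hb]; ring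
      _ = (fw F w 1 + Complex.I * fw F w 2) * den F w := by
        simp only [lorC] at hiso
        rw [den]
        linear_combination -hiso + fw F w 2 ^ 2 * Complex.I_sq
  have hd : den F w = fw F w 1 - Complex.I * fw F w 2 := rfl
  funext j
  fin_cases j <;> simp only [muMap, isotropicVec, Pi.smul_apply, smul_eq_mul, Fin.mk_one,
    Fin.zero_eta, Fin.reduceFinMk, Matrix.cons_val]
  · linear_combination -(ha + hb) / 2
  · linear_combination -(hab + hd) / 2
  · linear_combination Complex.I * (hab - hd) / 2 + fw F w 2 * Complex.I_sq
  · linear_combination -(ha - hb) / 2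

lemma hasWirtingerAt_div_den (hF : IsConformalImmersion F M) (hMo : IsOpen M)
    (humb : IsTotallyUmbilical F M) (hw : w ∈ M) (hden : den F w ≠ 0) (c : ℂ) :
    HasWirtingerAt (fun z => (fw F z 0 + c * fw F z 3) / den F z) 0
      (((fwwbar F w 0 + c * fwwbar F w 3) * den F w - (fw F w 0 + c * fw F w 3) *
        (fwwbar F w 1 - Complex.I * fwwbar F w 2)) / den F w ^ 2) w := by
  have hfw := hasWirtingerAt_fw hF.smooth hMo hw
  rw [hF.fww_eq_umbilicFactor_smul hMo humb hw, hasWirtingerAt_pi] at hfw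
  have hden' : HasWirtingerAt (den F) (umbilicFactor F w * den F w) _ w :=
    ((hfw 1).sub ((HasWirtingerAt.const Complex.I).mul (hfw 2))).congr_deriv
      (by simp [den]; ring) rfl
  have hnum := ((hfw 0).add ((HasWirtingerAt.const c).mul (hfw 3))).congr_deriv
    (p' := umbilicFactor F w * (fw F w 0 + c * fw F w 3)) (by simp; ring) rfl
  exact (hnum.div_of_proportional hden' hden).congr_deriv rfl (by simp)

lemma hasWirtingerAt_aMap (hF : IsConformalImmersion F M) (hMo : IsOpen M)
    (humb : IsTotallyUmbilical F M) (hw : w ∈ M) (hden : den F w ≠ 0) :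
    HasWirtingerAt (aMap F) 0 (((fwwbar F w 0 + fwwbar F w 3) * den F w -
      (fw F w 0 + fw F w 3) * (fwwbar F w 1 - Complex.I * fwwbar F w 2)) / den F w ^ 2) w := by
  have h := hF.hasWirtingerAt_div_den hMo humb hw hden 1
  simp only [one_mul] at h
  exact h

lemma hasWirtingerAt_bMap (hF : IsConformalImmersion F M) (hMo : IsOpen M)
    (humb : IsTotallyUmbilical F M) (hw : w ∈ M) (hden : den F w ≠ 0) :
    HasWirtingerAt (bMap F) 0 (((fwwbar F w 0 - fwwbar F w 3) * den F w -
      (fw F w 0 - fw F w 3) * (fwwbar F w 1 - Complex.I * fwwbar F w 2)) / den F w ^ 2) w := by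
  have h := hF.hasWirtingerAt_div_den hMo humb hw hden (-1)
  simp only [neg_one_mul, ← sub_eq_add_neg] at h
  exact h

lemma isConstantOn_data_of_null_normal (hF : IsConformalImmersion F M) (hMo : IsOpen M)
    (hMc : IsPreconnected M) (humb : IsTotallyUmbilical F M) (hden : ∀ w ∈ M, den F w ≠ 0)
    {n : L4} (hn0 : n ≠ 0) (hnull : lor n n = 0) (hn : ∀ w ∈ M, lorC (toC n) (fw F w) = 0) :
    IsConstantOn (aMap F) M ∨ IsConstantOn (bMap F) M := by
  obtain ⟨c, d, hcd⟩ := exists_eq_or_eq_of_orthogonal_null hn0 hnull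
  refine isConstantOn_or_isConstantOn_of_forall_eq_or_eq (c := c) (d := d) hMo hMc
    (fun w hw => ?_) (fun w hw => ?_) fun w hw => hcd _ _ ?_
  · exact (hF.hasWirtingerAt_aMap hMo humb hw
      (hden w hw)).differentiableAt_conj.differentiableWithinAt
  · exact (hF.hasWirtingerAt_bMap hMo humb hw
      (hden w hw)).differentiableAt_conj.differentiableWithinAt
  · have h := hn w hw
    rw [hF.fw_eq_muMap_smul_isotropicVec hw (hden w hw), lorC_smul_right] at h
    exact (mul_eq_zero.1 h).resolve_left (div_ne_zero (hden w hw) two_ne_zero)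

/-- If `⟨H, H⟩ = 0`, then `H` is constant: either the surface is minimal and `a` is constant, or
`H` is a null normal. -/
lemma lor_meanCurvature_self_ne_zero (hF : IsConformalImmersion F M) (hMo : IsOpen M)
    (hMc : IsPreconnected M) (humb : IsTotallyUmbilical F M) (hden : ∀ w ∈ M, den F w ≠ 0)
    (hac : ¬ IsConstantOn (aMap F) M) (hbc : ¬ IsConstantOn (bMap F) M) (hw : w ∈ M) :
    lor (meanCurvature F w) (meanCurvature F w) ≠ 0 := by
  intro hnull
  have hconst : ∀ z ∈ M, meanCurvature F z = meanCurvature F w := fun z hz => by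
    refine toC_injective (HasWirtingerAt.eq_of_isPreconnected (g := fun u => toC _) hMo hMc
      (fun u hu => ?_) hz hw)
    simpa [lor_meanCurvature_self_eq hF hMo hMc humb hu hw, hnull] using
      hF.hasWirtingerAt_meanCurvature hMo humb hu
  by_cases hH : meanCurvature F w = 0
  · refine hac (HasWirtingerAt.isConstantOn hMo hMc fun z hz =>
      (hF.hasWirtingerAt_aMap hMo humb hz (hden z hz)).congr_deriv rfl ?_)
    simp [← hF.conformalFactor_smul_meanCurvature hMo hz, hconst z hz, hH, toC_zero]
  · exact (hF.isConstantOn_data_of_null_normal hMo hMc humb hden hH hnull fun z hz =>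
      hconst z hz ▸ hF.lorC_meanCurvature_fw hMo hz).elim hac hbc

end IsConformalImmersion

/-! ### Translation into the light cone -/

lemma pos_of_pos_of_ne_zero {X : Type*} [TopologicalSpace X] {M : Set X} {g : X → ℝ}
    (hMc : IsPreconnected M) (hg : ContinuousOn g M) (hg0 : ∀ z ∈ M, g z ≠ 0) {w z : X}
    (hw : w ∈ M) (hgw : 0 < g w) (hz : z ∈ M) : 0 < g z := by
  by_contra! hgz
  obtain ⟨u, hu, hgu⟩ := hMc.intermediate_value hz hw hg ⟨hgz, hgw.le⟩
  exact hg0 u hu hgu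

lemma fw_add_const (F : ℂ → L4) (c : L4) : fw (fun z => F z + c) = fw F := by
  funext w j
  simp only [fw, dw, Pi.add_apply, Complex.ofReal_add, fderiv_add_const]

lemma sameData_add_const (F : ℂ → L4) (c : L4) (M : Set ℂ) :
    SameData (fun z => F z + c) F M := fun w _ => by
  simp only [aMap, bMap, muMap, den, fw_add_const, and_self]

lemma lor_inv_smul_sub {H u : L4} {s : ℝ} (hs : s ≠ 0) (hH : lor H H = s) (hu : lor u u = -s)
    (huH : lor u H = 0) : lor (s⁻¹ • (u - H)) (s⁻¹ • (u - H)) = 0 ∧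
      lor (s⁻¹ • (u - H)) u = -1 ∧ lor (s⁻¹ • (u - H)) H = -1 := by
  simp only [lor_smul_left, lor_smul_right, lor_sub_left, lor_sub_right, hH, hu, huH,
    lor_comm H u]
  exact ⟨by ring, by field_simp; ring, by field_simp; ring⟩

namespace IsConformalImmersion

variable {F : ℂ → L4} {M : Set ℂ} {w : ℂ} {s : ℝ}

lemma add_const (hF : IsConformalImmersion F M) (c : L4) :
    IsConformalImmersion (fun z => F z + c) M where
  smooth := hF.smooth.add contDiffOn_const
  immersion w hw := by
    rw [fderiv_add_const]
    exact hF.immersion w hw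
  isotropic := by
    rw [fw_add_const]
    exact hF.isotropic
  spacelike := by
    rw [fw_add_const]
    exact hF.spacelike

lemma continuousOn_meanCurvature_apply (hF : IsConformalImmersion F M) (hMo : IsOpen M)
    (j : Fin 4) : ContinuousOn (fun z => meanCurvature F z j) M :=
  Complex.continuous_re.comp_continuousOn
    (contDiffOn_pi.1 (hF.contDiffOn_meanCurvature hMo) j).continuousOn

lemma exists_null_translate (hF : IsConformalImmersion F M) (hMo : IsOpen M)
    (hMc : IsPreconnected M) (humb : IsTotallyUmbilical F M)
    (hs : ∀ z ∈ M, lor (meanCurvature F z) (meanCurvature F z) = s) (hs0 : s ≠ 0) {u : L4}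
    (hu : lor u u = -s) (huF : ∀ z ∈ M, lorC (toC u) (fw F z) = 0) :
    ∃ c : L4, ∀ z ∈ M, lor (F z + c) (F z + c) = 0 ∧ lor (F z + c) u = -1 ∧
      lor (F z + c) (meanCurvature F z) = -1 := by
  obtain ⟨p, hp⟩ := hF.exists_center hMo hMc hs hs0 humb
  refine ⟨s⁻¹ • u - p, fun z hz => ?_⟩
  have htranslate : F z + (s⁻¹ • u - p) = s⁻¹ • (u - meanCurvature F z) := by
    rw [add_sub_left_comm, hp z hz]
    module
  rw [htranslate]
  exact lor_inv_smul_sub hs0 (hs z hz) hu (hF.lor_meanCurvature_eq_zero_of_orthogonal hMo huF hz)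

lemma exists_mapsTo_futureCone_of_spacelike (hF : IsConformalImmersion F M) (hMo : IsOpen M)
    (hMc : IsPreconnected M) (humb : IsTotallyUmbilical F M) (hw : w ∈ M)
    (hH : 0 < lor (meanCurvature F w) (meanCurvature F w)) :
    ∃ c : L4, Set.MapsTo (fun z => F z + c) M futureCone := by
  have hs (z) (hz : z ∈ M) := hF.lor_meanCurvature_self_eq hMo hMc humb hz hw
  obtain ⟨v, hv, hvF⟩ := hF.exists_normal hMo hMc humb hw
  obtain ⟨u, hu, huF, hu0⟩ : ∃ u : L4, lor u u = lor v v ∧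
      (∀ z ∈ M, lorC (toC u) (fw F z) = 0) ∧ 0 < u 0 := by
    have hv0 : v 0 ≠ 0 := time_ne_zero_of_lor_self_neg (hv ▸ neg_lt_zero.2 hH)
    rcases hv0.lt_or_gt with hpast | hfuture
    · refine ⟨(-1 : ℝ) • v, ?_, fun z hz => ?_, by simpa using hpast⟩
      · rw [neg_one_smul, lor_neg_neg]
      · rw [toC_smul, lorC_smul_left, hvF z hz, mul_zero]
    · exact ⟨v, rfl, hvF, hfuture⟩
  obtain ⟨c, hc⟩ := hF.exists_null_translate hMo hMc humb hs hH.ne' (hu.trans hv) huF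
  refine ⟨c, fun z hz => ?_⟩
  obtain ⟨hnull, hcu, -⟩ := hc z hz
  exact mem_futureCone_of_lor_neg hnull (by linarith) hu0 (by linarith)

lemma exists_mapsTo_futureCone_of_timelike (hF : IsConformalImmersion F M) (hMo : IsOpen M)
    (hMc : IsPreconnected M) (humb : IsTotallyUmbilical F M) (hw : w ∈ M)
    (hH : lor (meanCurvature F w) (meanCurvature F w) < 0) (hH0 : 0 < meanCurvature F w 0) :
    ∃ c : L4, Set.MapsTo (fun z => F z + c) M futureCone := by
  have hs (z) (hz : z ∈ M) := hF.lor_meanCurvature_self_eq hMo hMc humb hz hw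
  obtain ⟨v, hv, hvF⟩ := hF.exists_normal hMo hMc humb hw
  obtain ⟨c, hc⟩ := hF.exists_null_translate hMo hMc humb hs hH.ne hv hvF
  have hfuture : ∀ z ∈ M, 0 < meanCurvature F z 0 := fun z hz =>
    pos_of_pos_of_ne_zero hMc (hF.continuousOn_meanCurvature_apply hMo 0)
      (fun u hu => time_ne_zero_of_lor_self_neg ((hs u hu).trans_lt hH)) hw hH0 hz
  refine ⟨c, fun z hz => ?_⟩
  obtain ⟨hnull, -, hcH⟩ := hc z hz
  exact mem_futureCone_of_lor_neg hnull ((hs z hz).trans_lt hH).le (hfuture z hz) (by linarith)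

lemma exists_mapsTo_futureCone (hF : IsConformalImmersion F M) (hMo : IsOpen M)
    (hMc : IsPreconnected M) (humb : IsTotallyUmbilical F M) (hw : w ∈ M)
    (hH : lor (meanCurvature F w) (meanCurvature F w) ≠ 0)
    (hpast : ¬ IsPastTimelike (meanCurvature F w)) :
    ∃ c : L4, Set.MapsTo (fun z => F z + c) M futureCone := by
  rcases hH.lt_or_gt with htime | hspace
  · exact hF.exists_mapsTo_futureCone_of_timelike hMo hMc humb hw htime
      ((time_ne_zero_of_lor_self_neg htime).lt_or_gt.resolve_left fun h => hpast ⟨htime, h⟩)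
  · exact hF.exists_mapsTo_futureCone_of_spacelike hMo hMc humb hw hspace

lemma exists_mapsTo_pastCone (hF : IsConformalImmersion F M) (hMo : IsOpen M)
    (hMc : IsPreconnected M) (humb : IsTotallyUmbilical F M)
    (hpast : ∀ z ∈ M, IsPastTimelike (meanCurvature F z)) :
    ∃ c : L4, Set.MapsTo (fun z => F z + c) M pastCone := by
  obtain rfl | ⟨w, hw⟩ := M.eq_empty_or_nonempty
  · exact ⟨0, Set.mapsTo_empty _ _⟩
  obtain ⟨v, hv, hvF⟩ := hF.exists_normal hMo hMc humb hw
  obtain ⟨c, hc⟩ := hF.exists_null_translate hMo hMc humb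
    (fun z hz => hF.lor_meanCurvature_self_eq hMo hMc humb hz hw) (hpast w hw).1.ne hv hvF
  refine ⟨c, fun z hz => ?_⟩
  obtain ⟨hnull, -, hcH⟩ := hc z hz
  exact mem_pastCone_of_lor_neg hnull (hpast z hz).1.le (hpast z hz).2 (by linarith)

end IsConformalImmersion

/-! ### Isometries -/

section Isometry

variable {K V : Type*} [Field K] [AddCommGroup V] [Module K V]
  {B : LinearMap.BilinForm K V} {v e : V}

lemma exists_isOrthogonal_map_eq_of_sub_ne_zero (hB : LinearMap.IsSymm B) (hve : B v v = B e e)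
    (hsub : B (v - e) (v - e) ≠ 0) : ∃ L : V ≃ₗ[K] V, B.IsOrthogonal L ∧ L v = e := by
  have hreflective : LinearMap.IsReflective B (v - e) :=
    ⟨IsRegular.of_ne_zero hsub, fun _ => (isUnit_iff_ne_zero.2 hsub).dvd⟩
  have hcoroot : LinearMap.IsReflective.coroot B hreflective v = 1 := by
    apply mul_left_cancel₀ hsub
    rw [LinearMap.IsReflective.apply_self_mul_coroot_apply]
    have hcomm : B e v = B v e := hB.eq e v
    simp only [map_sub, LinearMap.sub_apply, hcomm, ← hve]
    ring
  refine ⟨_, LinearMap.IsReflective.isOrthogonal_reflection B hreflective hB, ?_⟩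
  rw [Module.reflection_apply, hcoroot, one_smul, sub_sub_cancel]

lemma exists_isOrthogonal_map_eq [NeZero (2 : K)] (hB : LinearMap.IsSymm B) (hve : B v v = B e e)
    (hv : B v v ≠ 0) : ∃ L : V ≃ₗ[K] V, B.IsOrthogonal L ∧ L v = e := by
  by_cases hsub : B (v - e) (v - e) = 0
  · have hadd : B (v - -e) (v - -e) ≠ 0 := by
      have hparallelogram : B (v - e) (v - e) + B (v - -e) (v - -e) = 2 * (2 * B v v) := by
        simp only [map_sub, map_neg, LinearMap.sub_apply, LinearMap.neg_apply, ← hve]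
        ring
      rw [hsub, zero_add] at hparallelogram
      rw [hparallelogram]
      exact mul_ne_zero two_ne_zero (mul_ne_zero two_ne_zero hv)
    obtain ⟨L, hL, hLv⟩ := exists_isOrthogonal_map_eq_of_sub_ne_zero hB
      (show B v v = B (-e) (-e) by simp [hve]) hadd
    refine ⟨L.trans (LinearEquiv.neg K), fun x y => ?_, by simp [hLv]⟩
    simpa using hL x y
  · exact exists_isOrthogonal_map_eq_of_sub_ne_zero hB hve hsub

end Isometry

lemma exists_isOrthogonal_future {e v x : L4} (hve : lor v v = lor e e) (hv : lor v v ≠ 0)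
    (hx : lor x x < 0) : ∃ L : L4 ≃ₗ[ℝ] L4, lorForm.IsOrthogonal L ∧ (L v = e ∨ L v = -e) ∧
      0 < L x 0 := by
  obtain ⟨L, hL, hLv⟩ := exists_isOrthogonal_map_eq isSymm_lorForm hve hv
  rcases (time_ne_zero_of_lor_self_neg (show lor (L x) (L x) < 0 from
    (hL x x).trans_lt hx)).lt_or_gt with hpast | hfuture
  · exact ⟨L.trans (LinearEquiv.neg ℝ), fun y z => (lor_neg_neg _ _).trans (hL y z),
      Or.inr (by simp [hLv]), by simpa using hpast⟩
  · exact ⟨L, hL, Or.inl hLv, hfuture⟩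

lemma lor_single_zero (x : L4) : lor x (Pi.single 0 1) = -x 0 := by simp [lor]

lemma lor_single_three (x : L4) : lor x (Pi.single 3 1) = x 3 := by simp [lor]

lemma map_mem_roundSphere_iff {L : L4 ≃ₗ[ℝ] L4} (hL : lorForm.IsOrthogonal L) {v : L4}
    (hLv : L v = Pi.single 0 1) (r : ℝ) (x : L4) :
    L x ∈ roundSphere r ↔ lor x v = 0 ∧ lor x x = r ^ 2 := by
  have htime : lor x v = -L x 0 := by
    rw [← lor_single_zero, ← hLv]
    exact (hL x v).symm
  rw [htime, neg_eq_zero, ← show lor (L x) (L x) = lor x x from hL x x]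
  rfl

lemma map_mem_hyperbolicSurface_iff {L : L4 ≃ₗ[ℝ] L4} (hL : lorForm.IsOrthogonal L) {v : L4}
    (hLv : L v = Pi.single 3 1 ∨ L v = -Pi.single 3 1) (r : ℝ) (x : L4) :
    L x ∈ hyperbolicSurface r ↔ lor x v = 0 ∧ lor x x = -r ^ 2 ∧ 0 < L x 0 := by
  have hthree : L x 3 = 0 ↔ lor x v = 0 := by
    rw [← show lor (L x) (L v) = lor x v from hL x v]
    rcases hLv with h | h <;> simp [h, lor_neg_right, lor_single_three]
  rw [← hthree, ← show lor (L x) (L x) = lor x x from hL x x]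
  rfl

lemma congruentToOpenPiece_of_locally_subset {S Q : Set L4} {L : L4 ≃ₗ[ℝ] L4}
    (hL : lorForm.IsOrthogonal L) (p : L4) (hSQ : ∀ x ∈ S, L (x - p) ∈ Q)
    (hloc : ∀ x ∈ S, ∃ U : Set L4, IsOpen U ∧ x ∈ U ∧ ∀ y ∈ U, L (y - p) ∈ Q → y ∈ S) :
    CongruentToOpenPiece S Q := by
  let T : L4 ≃ᵃ[ℝ] L4 := (AffineEquiv.vaddConst ℝ p).symm.trans L.toAffineEquiv
  have hT : ∀ x, T x = L (x - p) := fun x => rfl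
  choose! U hUo hxU hU using hloc
  refine ⟨T '' (⋃ x ∈ S, U x), T.toContinuousAffineEquiv.toHomeomorph.isOpenMap _
    (isOpen_biUnion hUo), T, fun x y => ?_, Set.Subset.antisymm ?_ ?_⟩
  · rw [hT, hT, ← map_sub, sub_sub_sub_cancel_right]
    exact hL _ _
  · rintro _ ⟨x, hx, rfl⟩
    exact ⟨Set.mem_image_of_mem T (Set.mem_biUnion hx (hxU x hx)), hSQ x hx⟩
  · rintro _ ⟨⟨y, hy, rfl⟩, hyQ⟩
    obtain ⟨x, hx, hyx⟩ := Set.mem_iUnion₂.1 hy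
    exact Set.mem_image_of_mem T (hU x hx y hyx hyQ)

/-! ### Umbilical surfaces as open pieces of quadrics -/

lemma HasWirtingerAt.image_mem_nhds {g : ℂ → ℂ} {p w : ℂ} {U : Set ℂ}
    (hg : HasWirtingerAt g p 0 w) (hp : p ≠ 0) (hsmooth : ContDiffAt ℝ 1 g w) (hU : U ∈ nhds w) :
    g '' U ∈ nhds (g w) := by
  rw [← (hsmooth.hasStrictFDerivAt' hg one_ne_zero).map_nhds_eq_of_surj
    (LinearMap.range_eq_top.2 fun c => ⟨c / p, by simp [hp]⟩)]
  exact Filter.image_mem_map hU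

lemma eq_of_sub_eq_smul_of_lor_neg {x y h : L4} {c : ℝ} (hxy : x - y = c • h)
    (hnorm : lor x x = lor y y) (hx : lor x h < 0) (hy : lor y h < 0) : x = y := by
  have hprod : c * (lor x h + lor y h) = 0 := by
    rw [← lor_add_left, ← lor_smul_right, ← hxy, lor_add_left, lor_sub_right, lor_sub_right,
      hnorm, lor_comm y x]
    ring
  have hc : c = 0 := (mul_eq_zero.1 hprod).resolve_right (add_neg hx hy).ne
  rwa [hc, zero_smul, sub_eq_zero] at hxy

namespace IsConformalImmersion

variable {F : ℂ → L4} {M : Set ℂ} {w : ℂ} {s : ℝ} {p v : L4}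

lemma eq_smul_of_orthogonal (hF : IsConformalImmersion F M) (hw : w ∈ M) {u v d : L4}
    (hu : lorC (toC u) (fw F w) = 0) (hv : lorC (toC v) (fw F w) = 0)
    (hd : lorC (toC d) (fw F w) = 0) (huv : lor u v = 0) (huu : lor u u ≠ 0) (hvv : lor v v ≠ 0)
    (hdu : lor d u = 0) : d = (lor d v / lor v v) • v := by
  set e := d - (lor d v / lor v v) • v with he
  have hew : lorC (toC e) (fw F w) = 0 := by
    rw [he, toC_sub, toC_smul, lorC_sub_left, lorC_smul_left, hd, hv, mul_zero, sub_zero]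
  have heu : lor e u = 0 := by
    rw [he, lor_sub_left, lor_smul_left, hdu, lor_comm v u, huv, mul_zero, sub_zero]
  have hev : lor e v = 0 := by
    rw [he, lor_sub_left, lor_smul_left, div_mul_cancel₀ _ hvv, sub_self]
  have hconj {x : L4} (hx : lorC (toC x) (fw F w) = 0) : lorC (conjVec (fw F w)) (toC x) = 0 :=
    (lorC_comm _ _).trans (lorC_toC_conjVec_eq_zero_iff.2 hx)
  have he0 : toC e = 0 := eq_zero_of_orthogonal_hyperbolic_pair (hF.isotropic w hw)
    (by rw [lorC_conjVec_conjVec, hF.isotropic w hw, map_zero]) (hF.conformalFactor_ne_zero hw)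
    ((lorC_comm _ _).trans hu) (hconj hu) ((lorC_comm _ _).trans hv) (hconj hv)
    (by rw [lorC_toC_toC, huv, Complex.ofReal_zero])
    (by rwa [lorC_toC_toC, Complex.ofReal_ne_zero])
    (by rwa [lorC_toC_toC, Complex.ofReal_ne_zero])
    ((lorC_comm _ _).trans hew) (hconj hew)
    (by rw [lorC_toC_toC, lor_comm, heu, Complex.ofReal_zero])
    (by rw [lorC_toC_toC, lor_comm, hev, Complex.ofReal_zero])
  exact sub_eq_zero.1 (toC_injective (he0.trans toC_zero.symm))

lemma image_tangentProjection_mem_nhds (hF : IsConformalImmersion F M) (hMo : IsOpen M)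
    (hw : w ∈ M) {U : Set ℂ} (hU : U ∈ nhds w) :
    (fun z => lorC (toC (F z)) (conjVec (fw F w))) '' U ∈
      nhds (lorC (toC (F w)) (conjVec (fw F w))) := by
  have hderiv : HasWirtingerAt (fun z => lorC (toC (F z)) (conjVec (fw F w)))
      (conformalFactor F w) 0 w := by
    refine ((hasWirtingerAt_toC_comp hF.smooth hMo hw).fun_lorC
      (HasWirtingerAt.const (conjVec (fw F w)))).congr_deriv ?_ ?_
    · rw [lorC_zero_right, add_zero, conformalFactor]
    · rw [lorC_zero_right, add_zero, lorC_conjVec_conjVec, hF.isotropic w hw, map_zero]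
  refine hderiv.image_mem_nhds (hF.conformalFactor_ne_zero hw) ?_ hU
  exact ((contDiffOn_lorC (contDiffOn_pi.2 fun j => contDiffOn_toC_comp hF.smooth j)
    contDiffOn_const).contDiffAt (hMo.mem_nhds hw)).of_le (by exact_mod_cast le_top)

lemma lor_sub_center_self (hs : lor (meanCurvature F w) (meanCurvature F w) = s) (hs0 : s ≠ 0)
    (hp : F w - p = -s⁻¹ • meanCurvature F w) : lor (F w - p) (F w - p) = s⁻¹ := by
  rw [hp, lor_smul_left, lor_smul_right, hs]
  field_simp

lemma lor_sub_center_normal (hF : IsConformalImmersion F M) (hMo : IsOpen M) (hw : w ∈ M)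
    (hp : F w - p = -s⁻¹ • meanCurvature F w) (hv : ∀ z ∈ M, lorC (toC v) (fw F z) = 0) :
    lor (F w - p) v = 0 := by
  rw [hp, lor_smul_left, lor_comm, hF.lor_meanCurvature_eq_zero_of_orthogonal hMo hv hw, mul_zero]

/-- Near `F w`, a point of the quadric is determined by its projection to the tangent plane at
`F w`, and these projections of `F` cover a neighborhood. -/
lemma exists_isOpen_inter_quadric_subset_image (hF : IsConformalImmersion F M) (hMo : IsOpen M)
    (hs : ∀ z ∈ M, lor (meanCurvature F z) (meanCurvature F z) = s) (hs0 : s ≠ 0)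
    (hp : ∀ z ∈ M, F z - p = -s⁻¹ • meanCurvature F z) (hvv : lor v v ≠ 0)
    (hv : ∀ z ∈ M, lorC (toC v) (fw F z) = 0) (hw : w ∈ M) :
    ∃ U : Set L4, IsOpen U ∧ F w ∈ U ∧ ∀ x ∈ U, lor (x - p) v = 0 →
      lor (x - p) (x - p) = s⁻¹ → x ∈ F '' M := by
  set H := meanCurvature F w
  let π : L4 → ℂ := fun x => lorC (toC x) (conjVec (fw F w))
  have hπ : Continuous π := by
    simp only [π, lorC, toC]
    fun_prop
  let V : Set L4 := {x | lor (x - p) H < 0}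
  have hVo : IsOpen V :=
    isOpen_lt ((continuous_lor_left H).comp (continuous_sub_right p)) continuous_const
  have hwV : F w ∈ V := by
    change lor (F w - p) H < 0
    rw [hp w hw, lor_smul_left, hs w hw, neg_mul, inv_mul_cancel₀ hs0]
    exact neg_one_lt_zero
  have hnear : M ∩ F ⁻¹' V ∈ nhds w := Filter.inter_mem (hMo.mem_nhds hw)
    ((hF.smooth.contDiffAt (hMo.mem_nhds hw)).continuousAt (hVo.mem_nhds hwV))
  refine ⟨V ∩ π ⁻¹' interior ((π ∘ F) '' (M ∩ F ⁻¹' V)),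
    hVo.inter (isOpen_interior.preimage hπ), ⟨hwV, mem_interior_iff_mem_nhds.2
      (hF.image_tangentProjection_mem_nhds hMo hw hnear)⟩, ?_⟩
  rintro x ⟨hxV, hxπ⟩ hxv hxs
  obtain ⟨z, ⟨hzM, hzV⟩, hzx⟩ := interior_subset hxπ
  have htangent : lorC (toC (F z - x)) (fw F w) = 0 := by
    rw [← lorC_toC_conjVec_eq_zero_iff, toC_sub, lorC_sub_left, sub_eq_zero]
    exact hzx
  have hnormal : lor (F z - x) v = 0 := by
    rw [← sub_sub_sub_cancel_right _ _ p, lor_sub_left, hxv,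
      hF.lor_sub_center_normal hMo hzM (hp z hzM) hv, sub_zero]
  have hline := hF.eq_smul_of_orthogonal hw (hv w hw) (hF.lorC_meanCurvature_fw hMo hw) htangent
    (hF.lor_meanCurvature_eq_zero_of_orthogonal hMo hv hw) hvv (by rwa [hs w hw]) hnormal
  rw [← sub_sub_sub_cancel_right _ _ p] at hline
  exact ⟨z, hzM, sub_left_injective (eq_of_sub_eq_smul_of_lor_neg hline
    ((lor_sub_center_self (hs z hzM) hs0 (hp z hzM)).trans hxs.symm) hzV hxV)⟩

lemma lor_normal_mul_lor_meanCurvature_neg (hF : IsConformalImmersion F M) (hMo : IsOpen M)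
    (hMc : IsPreconnected M) (humb : IsTotallyUmbilical F M) (hw : w ∈ M)
    (hH0 : lor (meanCurvature F w) (meanCurvature F w) ≠ 0) (hvv : lor v v ≠ 0)
    (hv : ∀ z ∈ M, lorC (toC v) (fw F z) = 0) :
    lor v v * lor (meanCurvature F w) (meanCurvature F w) < 0 := by
  obtain ⟨n, hn, hnF⟩ := hF.exists_normal hMo hMc humb hw
  have hHn : lor (meanCurvature F w) n = 0 :=
    (lor_comm _ _).trans (hF.lor_meanCurvature_eq_zero_of_orthogonal hMo hnF hw)
  obtain ⟨c, rfl⟩ : ∃ c : ℝ, v = c • n := ⟨_, hF.eq_smul_of_orthogonal hw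
    (hF.lorC_meanCurvature_fw hMo hw) (hnF w hw) (hv w hw) hHn hH0 (hn ▸ neg_ne_zero.2 hH0)
    (hF.lor_meanCurvature_eq_zero_of_orthogonal hMo hv hw)⟩
  have hc : c ≠ 0 := by
    rintro rfl
    exact hvv (by rw [lor_smul_left, zero_mul])
  rw [lor_smul_left, lor_smul_right, hn]
  linarith [sq_pos_of_ne_zero (mul_ne_zero hc hH0)]

lemma exists_congruentToOpenPiece_roundSphere (hF : IsConformalImmersion F M) (hMo : IsOpen M)
    (hMc : IsPreconnected M) (humb : IsTotallyUmbilical F M) (hw : w ∈ M)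
    (hH0 : lor (meanCurvature F w) (meanCurvature F w) ≠ 0)
    (hv : ∀ z ∈ M, lorC (toC v) (fw F z) = 0) (hvv : lor v v = -1) :
    ∃ r : ℝ, 0 < r ∧ CongruentToOpenPiece (F '' M) (roundSphere r) := by
  have hvv0 : lor v v ≠ 0 := by norm_num [hvv]
  have hsign := hF.lor_normal_mul_lor_meanCurvature_neg hMo hMc humb hw hH0 hvv0 hv
  have hs (z) (hz : z ∈ M) := hF.lor_meanCurvature_self_eq hMo hMc humb hz hw
  generalize lor (meanCurvature F w) (meanCurvature F w) = s at *
  obtain ⟨p, hp⟩ := hF.exists_center hMo hMc hs hH0 humb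
  have hr0 : 0 < s⁻¹ := inv_pos.2 (by rw [hvv] at hsign; linarith)
  have hr : Real.sqrt s⁻¹ ^ 2 = s⁻¹ := Real.sq_sqrt hr0.le
  obtain ⟨L, hL, hLv⟩ := exists_isOrthogonal_map_eq (e := Pi.single 0 1) isSymm_lorForm
    (show lor v v = lor _ _ by rw [hvv]; simp [lor]) hvv0
  refine ⟨Real.sqrt s⁻¹, Real.sqrt_pos.2 hr0, congruentToOpenPiece_of_locally_subset hL p ?_ ?_⟩
  all_goals
    rintro _ ⟨z, hz, rfl⟩
    simp only [map_mem_roundSphere_iff hL hLv, hr]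
  · exact ⟨hF.lor_sub_center_normal hMo hz (hp z hz) hv,
      lor_sub_center_self (hs z hz) hH0 (hp z hz)⟩
  · obtain ⟨U, hUo, hzU, hU⟩ :=
      hF.exists_isOpen_inter_quadric_subset_image hMo hs hH0 hp hvv0 hv hz
    exact ⟨U, hUo, hzU, fun y hy hyQ => hU y hy hyQ.1 hyQ.2⟩

lemma exists_congruentToOpenPiece_hyperbolicSurface (hF : IsConformalImmersion F M)
    (hMo : IsOpen M) (hMc : IsPreconnected M) (humb : IsTotallyUmbilical F M) (hw : w ∈ M)
    (hH0 : lor (meanCurvature F w) (meanCurvature F w) ≠ 0)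
    (hv : ∀ z ∈ M, lorC (toC v) (fw F z) = 0) (hvv : lor v v = 1) :
    ∃ r : ℝ, 0 < r ∧ CongruentToOpenPiece (F '' M) (hyperbolicSurface r) := by
  have hvv0 : lor v v ≠ 0 := by norm_num [hvv]
  have hsign := hF.lor_normal_mul_lor_meanCurvature_neg hMo hMc humb hw hH0 hvv0 hv
  have hs (z) (hz : z ∈ M) := hF.lor_meanCurvature_self_eq hMo hMc humb hz hw
  generalize lor (meanCurvature F w) (meanCurvature F w) = s at *
  obtain ⟨p, hp⟩ := hF.exists_center hMo hMc hs hH0 humb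
  have hr0 : 0 < -s⁻¹ := neg_pos.2 (inv_lt_zero.2 (by rw [hvv] at hsign; linarith))
  have hr : -Real.sqrt (-s⁻¹) ^ 2 = s⁻¹ := by rw [Real.sq_sqrt hr0.le, neg_neg]
  have hquadric (z) (hz : z ∈ M) := lor_sub_center_self (hs z hz) hH0 (hp z hz)
  obtain ⟨L, hL, hLv, hLw⟩ := exists_isOrthogonal_future (e := Pi.single 3 1)
    (by rw [hvv]; simp [lor]) hvv0 ((hquadric w hw).trans_lt (neg_pos.1 hr0))
  have hLcont : Continuous fun x => L (x - p) 0 :=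
    (continuous_apply 0).comp
      (L.toContinuousLinearEquiv.continuous.comp (continuous_sub_right p))
  have hfuture : ∀ z ∈ M, 0 < L (F z - p) 0 := fun z hz =>
    pos_of_pos_of_ne_zero hMc (hLcont.comp_continuousOn hF.smooth.continuousOn)
      (fun u hu => time_ne_zero_of_lor_self_neg
        ((hL _ _).trans_lt ((hquadric u hu).trans_lt (neg_pos.1 hr0)))) hw hLw hz
  refine ⟨Real.sqrt (-s⁻¹), Real.sqrt_pos.2 hr0,
    congruentToOpenPiece_of_locally_subset hL p ?_ ?_⟩
  all_goals
    rintro _ ⟨z, hz, rfl⟩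
    simp only [map_mem_hyperbolicSurface_iff hL hLv, hr]
  · exact ⟨hF.lor_sub_center_normal hMo hz (hp z hz) hv, hquadric z hz, hfuture z hz⟩
  · obtain ⟨U, hUo, hzU, hU⟩ :=
      hF.exists_isOpen_inter_quadric_subset_image hMo hs hH0 hp hvv0 hv hz
    exact ⟨U, hUo, hzU, fun y hy hyQ => hU y hy hyQ.1 hyQ.2.1⟩

lemma orthogonal_fw_of_image_subset_affHyperplane (hF : IsConformalImmersion F M)
    (hMo : IsOpen M) (hsub : F '' M ⊆ affHyperplane p v) (hw : w ∈ M) :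
    lorC (toC v) (fw F w) = 0 := by
  refine orthogonal_fw_of_lor_eq_const hF.smooth hMo (c := lor v p) (fun z hz => ?_) hw
  have hz' : lor (F z - p) v = 0 := hsub ⟨z, hz, rfl⟩
  rwa [lor_comm, lor_sub_right, sub_eq_zero] at hz'

lemma image_subset_affHyperplane (hF : IsConformalImmersion F M) (hMo : IsOpen M)
    (hMc : IsPreconnected M) (hv : ∀ z ∈ M, lorC (toC v) (fw F z) = 0) (hw : w ∈ M) :
    F '' M ⊆ affHyperplane (F w) v := by
  rintro _ ⟨z, hz, rfl⟩
  change lor (F z - F w) v = 0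
  rw [lor_comm, lor_sub_right, sub_eq_zero]
  exact lor_eq_lor_of_orthogonal_fw hF.smooth hMo hMc hv hz hw

lemma exists_unit_normal (hF : IsConformalImmersion F M) (hMo : IsOpen M)
    (hMc : IsPreconnected M) (humb : IsTotallyUmbilical F M) (hw : w ∈ M)
    (hH0 : lor (meanCurvature F w) (meanCurvature F w) ≠ 0) :
    ∃ v : L4, (lor v v = -1 ∨ lor v v = 1) ∧ ∀ z ∈ M, lorC (toC v) (fw F z) = 0 := by
  obtain ⟨n, hn, hnF⟩ := hF.exists_normal hMo hMc humb hw
  have hn0 : lor n n ≠ 0 := hn ▸ neg_ne_zero.2 hH0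
  obtain ⟨c, hc⟩ : ∃ c : ℝ, c * c * |lor n n| = 1 := ⟨(Real.sqrt |lor n n|)⁻¹, by
    rw [← mul_inv, Real.mul_self_sqrt (abs_nonneg _), inv_mul_cancel₀ (abs_ne_zero.2 hn0)]⟩
  refine ⟨c • n, ?_, fun z hz => by rw [toC_smul, lorC_smul_left, hnF z hz, mul_zero]⟩
  rw [lor_smul_left, lor_smul_right, ← mul_assoc]
  rcases abs_choice (lor n n) with h | h <;> rw [h] at hc
  · exact Or.inr hc
  · exact Or.inl (by linarith)

end IsConformalImmersion

theorem mainTheorem2_general (M : Set ℂ) (hMo : IsOpen M) (hMc : IsConnected M) (F : ℂ → L4)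
    (hF : IsConformalImmersion F M)
    (hden : ∀ w ∈ M, den F w ≠ 0)
    (humb : IsTotallyUmbilical F M)
    (hac : ¬ IsConstantOn (aMap F) M) (hbc : ¬ IsConstantOn (bMap F) M) :
    ((∃ w ∈ M, ¬ IsPastTimelike (meanCurvature F w)) →
      ∃ f : ℂ → L4, IsConformalImmersion f M ∧ Set.MapsTo f M futureCone ∧ SameData f F M) ∧
    ((∀ w ∈ M, IsPastTimelike (meanCurvature F w)) →
      ∃ f : ℂ → L4, IsConformalImmersion f M ∧ Set.MapsTo f M pastCone ∧ SameData f F M) ∧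
    (∃ v : L4, (lor v v = -1 ∨ lor v v = 1) ∧
      ∀ w₀ ∈ M, F '' M ⊆ affHyperplane (F w₀) v) ∧
    (∀ v : L4, ∀ w₀ ∈ M, F '' M ⊆ affHyperplane (F w₀) v →
      (lor v v = -1 → ∃ r : ℝ, 0 < r ∧ CongruentToOpenPiece (F '' M) (roundSphere r)) ∧
      (lor v v = 1 → ∃ r : ℝ, 0 < r ∧
        CongruentToOpenPiece (F '' M) (hyperbolicSurface r))) := by
  have hMp := hMc.isPreconnected
  have hH0 (w) (hw : w ∈ M) := hF.lor_meanCurvature_self_ne_zero hMo hMp humb hden hac hbc hw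
  obtain ⟨w₁, hw₁⟩ := hMc.nonempty
  refine ⟨?_, fun hpast => ?_, ?_, fun v w₀ hw₀ hsub => ?_⟩
  · rintro ⟨w, hw, hw_past⟩
    obtain ⟨c, hc⟩ := hF.exists_mapsTo_futureCone hMo hMp humb hw (hH0 w hw) hw_past
    exact ⟨_, hF.add_const c, hc, sameData_add_const F c M⟩
  · obtain ⟨c, hc⟩ := hF.exists_mapsTo_pastCone hMo hMp humb hpast
    exact ⟨_, hF.add_const c, hc, sameData_add_const F c M⟩
  · obtain ⟨v, hvv, hv⟩ := hF.exists_unit_normal hMo hMp humb hw₁ (hH0 w₁ hw₁)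
    exact ⟨v, hvv, fun w₀ hw₀ => hF.image_subset_affHyperplane hMo hMp hv hw₀⟩
  · have hv (z) (hz : z ∈ M) := hF.orthogonal_fw_of_image_subset_affHyperplane hMo hsub hz
    exact ⟨hF.exists_congruentToOpenPiece_roundSphere hMo hMp humb hw₀ (hH0 w₀ hw₀) hv,
      hF.exists_congruentToOpenPiece_hyperbolicSurface hMo hMp humb hw₀ (hH0 w₀ hw₀) hv⟩

theorem mainTheorem2 (M : Set ℂ) (hMo : IsOpen M) (hMc : IsConnected M)
    (hMs : IsSimplyConnected M) (F : ℂ → L4)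
    (hF : IsConformalImmersion F M)
    (hden : ∀ w ∈ M, den F w ≠ 0)
    (humb : IsTotallyUmbilical F M)
    (ha : IsAntiHolomorphicOn (aMap F) M) (hb : IsAntiHolomorphicOn (bMap F) M)
    (hac : ¬ IsConstantOn (aMap F) M) (hbc : ¬ IsConstantOn (bMap F) M) :
    ((∃ w ∈ M, ¬ IsPastTimelike (meanCurvature F w)) →
      ∃ f : ℂ → L4, IsConformalImmersion f M ∧ Set.MapsTo f M futureCone ∧ SameData f F M) ∧
    ((∀ w ∈ M, IsPastTimelike (meanCurvature F w)) →
      ∃ f : ℂ → L4, IsConformalImmersion f M ∧ Set.MapsTo f M pastCone ∧ SameData f F M) ∧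
    (∃ v : L4, (lor v v = -1 ∨ lor v v = 1) ∧
      ∀ w₀ ∈ M, F '' M ⊆ affHyperplane (F w₀) v) ∧
    (∀ v : L4, ∀ w₀ ∈ M, F '' M ⊆ affHyperplane (F w₀) v →
      (lor v v = -1 → ∃ r : ℝ, 0 < r ∧ CongruentToOpenPiece (F '' M) (roundSphere r)) ∧
      (lor v v = 1 → ∃ r : ℝ, 0 < r ∧
        CongruentToOpenPiece (F '' M) (hyperbolicSurface r))) := by
  exact mainTheorem2_general M hMo hMc F hF hden humb hac hbc
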